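/- Let $X_1,X_2,\dots$ be i.i.d. real random variables (the damage per cycle) with distribution $F_X$ and mean $\mu_X>0$. Put $S_n=X_1+\cdots+X_n$ and, for a threshold $s_*>0$, let $N_*=\inf\{n\ge 1: S_n>s_*\}$. Let $T_*=\inf\{t\ge 0: S_t>s_*\}$ be its continuous-time counterpart, where $t\mapsto S_t$ is the linear interpolation of $n\mapsto S_n$ with $S_0=0$ (with $\inf\emptyset=\infty$). For $1<\alpha\le 2$, $\sigma>0$, $\mu\in\mathbb R$ let $S_\alpha(\sigma,0,\mu)$ be the stable law with characteristic function $u\mapsto\exp(i\mu u-\sigma^\alpha|u|^\alpha)$, so that $S_2(\sigma,0,\mu)=N(\mu,2\sigma^2)$. Let $d_\alpha(F,G)=\inf(\mathbb E|X-Y|^\alpha)^{1/\alpha}$ be the Mallows distance, the infimum being over all pairs $(X,Y)$ with marginals $F$ and $G$. Let $1<\alpha\le 2$ and assume $d_\alpha(F_X,G_\alpha)<\infty$ for $G_\alpha=S_\alpha(\sigma,0,\mu)$, with some $\sigma>0$ and $\mu\in\mathbb R$. If $\alpha=2$, assume also that $X_1$ is not almost surely constant; then $X_1$ has finite variance $\sigma_X^2>0$.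 Let $\Phi_\alpha$ be the c.d.f. of $S_\alpha(\sigma,0,0)$ if $\alpha<2$, and let $\Phi_2$ be the c.d.f. of $S_2(\sigma_X/\sqrt2,0,0)=N(0,\sigma_X^2)$ if $\alpha=2$. Put $$a_\alpha=\frac1{\mu_X^{1/\alpha}s_*^{1-1/\alpha}},\qquad b_\alpha=\frac{s_*}{\mu_X},\qquad \xi_\alpha(x)=x^{1-1/\alpha}-x^{-1/\alpha}\quad(x>0).$$ Then: (i) For every $s_*>0$ there is exactly one probability distribution on $(0,\infty)$ whose c.d.f. is $t\mapsto\Phi_\alpha\big(\tfrac1{a_\alpha}\xi_\alpha(\tfrac t{b_\alpha})\big)$, $t>0$. (ii) This distribution approximates those of $N_*$ and $T_*$: for every $\varepsilon>0$ there is $M$ such that for all $s_*,t>0$ with $\max(s_*,t)\ge M$, $$\Big|\mathbb P(N_*\le t)-\Phi_\alpha\Big(\tfrac1{a_\alpha}\xi_\alpha\big(\tfrac t{b_\alpha}\big)\Big)\Big|\le\varepsilon\quad\text{and}\quad\Big|\mathbb P(T_*\le t)-\Phi_\alpha\Big(\tfrac1{a_\alpha}\xi_\alpha\big(\tfrac t{b_\alpha}\big)\Big)\Big|\le\varepsilon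 .$$ (iii) For $\alpha=2$ it is the classical Birnbaum–Saunders law: $\Phi_2\big(\tfrac1{a_2}\xi_2(\tfrac t{b_2})\big)=\Phi\big(\tfrac1a\,\xi(\tfrac tb)\big)$ for all $s_*,t>0$, where $\Phi$ is the c.d.f. of $N(0,1)$, $a=\sigma_X/\sqrt{\mu_Xs_*}$, $b=s_*/\mu_X$ and $\xi(x)=\sqrt x-1/\sqrt x$. -/

import Mathlib

open MeasureTheory ProbabilityTheory
open scoped ENNReal NNReal

noncomputable section

/-- `G` is the stable law `S_α(σ, 0, μ)` on the real line, i.e. the probability measure with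
characteristic function `t ↦ exp (i μ t - σ ^ α |t| ^ α)`.
In this parametrization `S_2(σ, 0, μ)` is the normal law `N(μ, 2 σ²)`. -/
structure IsSymmStable (α σ μ : ℝ) (G : Measure ℝ) : Prop where
  isProbabilityMeasure : IsProbabilityMeasure G
  charFun_eq : ∀ t : ℝ,
    charFun G t = Complex.exp ((μ * t : ℝ) * Complex.I - ((σ ^ α * |t| ^ α : ℝ) : ℂ))

/-- The Mallows (Wasserstein) distance `d_r(F, G)`: the infimum of `(E |X - Y| ^ r) ^ (1 / r)` over
all joint laws `π` of pairs `(X, Y)` with marginals `F` and `G`; it may be infinite. -/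
def mallowsDist (r : ℝ) (F G : Measure ℝ) : ℝ≥0∞ :=
  ⨅ (π : Measure (ℝ × ℝ)) (_ : π.map Prod.fst = F ∧ π.map Prod.snd = G),
    (∫⁻ p, ENNReal.ofReal (|p.1 - p.2| ^ r) ∂π) ^ (1 / r)

variable {Ω : Type*}

/-- `S_n = X_1 + ⋯ + X_n`, where `X_1, X_2, …` is the sequence `X 0, X 1, …`. -/
def partialSum (X : ℕ → Ω → ℝ) (n : ℕ) (ω : Ω) : ℝ :=
  ∑ j ∈ Finset.range n, X j ω

/-- The number of cycles to failure `N_* = inf {n ≥ 1 : S_n > s}`, equal to `∞` if the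
threshold `s` is never exceeded. -/
def cyclesToFailure (X : ℕ → Ω → ℝ) (s : ℝ) (ω : Ω) : ℕ∞ :=
  ⨅ (n : ℕ) (_ : 1 ≤ n ∧ s < partialSum X n ω), (n : ℕ∞)

/-- The cumulative damage in continuous time: the piecewise linear function of `t ≥ 0` that
takes the value `S_n` at each integer `n`. -/
def damageAt (X : ℕ → Ω → ℝ) (t : ℝ≥0) (ω : Ω) : ℝ :=
  partialSum X ⌊t⌋₊ ω + ((t : ℝ) - (⌊t⌋₊ : ℝ)) * X ⌊t⌋₊ ω

/-- The fatigue life `T_*` in continuous time: the first passage time above `s` of the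
continuous-time cumulative damage, equal to `∞` if `s` is never exceeded. -/
def fatigueLife (X : ℕ → Ω → ℝ) (s : ℝ) (ω : Ω) : ℝ≥0∞ :=
  ⨅ (t : ℝ≥0) (_ : s < damageAt X t ω), (t : ℝ≥0∞)

/-- `a_α = 1 / (m ^ (1 / α) * s ^ (1 - 1 / α))` for mean damage `m` and threshold `s`. -/
def bsShape (α m s : ℝ) : ℝ := 1 / (m ^ (1 / α) * s ^ (1 - 1 / α))

/-- `b_α = s / m` for mean damage `m` and threshold `s`. -/
def bsScale (m s : ℝ) : ℝ := s / m

/-- `ξ_α(x) = x ^ (1 - 1 / α) - 1 / x ^ (1 / α)`, used for `x > 0`. -/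
def bsXi (α x : ℝ) : ℝ := x ^ (1 - 1 / α) - 1 / x ^ (1 / α)

/-- `t ↦ Φ((1 / a_α) ξ_α(t / b_α))` with `Φ` the c.d.f. of `G`, used for `t > 0`. -/
def bsCdf (G : Measure ℝ) (α m s t : ℝ) : ℝ :=
  cdf G (1 / bsShape α m s * bsXi α (t / bsScale m s))

end

/-! The argument of `bsCdf` simplifies to `(t * m - s) / t ^ (1 / α)`, an increasing bijection of
`(0, ∞)` onto `ℝ`. Hence (i): the law is the pushforward of `G₀` under the inverse bijection. Part
(iii) is a rescaling of the normal law.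

For (ii), passage by time `t` means that the running maximum of the walk has exceeded `s`; for the
interpolated path this holds up to one extra step. Since the drift is positive, the running maximum
exceeds the endpoint only by an amount bounded in probability (time reversal and the strong law,
`measureReal_exists_lt_partialSum_le`). So the probability of passage lies between `P(S_n > s)` and
`P(S_{n+1} > s - K)` plus a small error, and constant shifts disappear after division by `n ^ (1 /
α)`. The central limit theorem, made uniform in the level by `tendstoUniformly_of_monotone`, settles
large `t`. If `t` is bounded and `s` is large, both probabilities are small.

The central limit theorem is classical for `α = 2`, because finite Mallows distance to a normal law
gives a second moment. For `α < 2`, couple `X_1` with the stable law at finite cost and add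
independent copies of the pair. The centred difference has mean zero and a finite moment of order
`α`, so the characteristic function of its normalized sums tends to `1`, while the normalized stable
sums have exactly the limit law (`tendsto_charFun_partialSum_of_mallowsDist`). -/

open Filter Topology

/-! ### Uniform convergence of distribution functions -/

/-- Pólya's theorem: pointwise convergence of monotone functions with values in `[0, 1]` to a
continuous distribution function is uniform. -/
theorem tendstoUniformly_of_monotone {ι : Type*} {l : Filter ι} {F : ι → ℝ → ℝ} {Φ : ℝ → ℝ}
    (hF : ∀ i, Monotone (F i)) (hF0 : ∀ i x, 0 ≤ F i x) (hF1 : ∀ i x, F i x ≤ 1)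
    (hΦ : Continuous Φ) (hmono : Monotone Φ) (hbot : Tendsto Φ atBot (𝓝 0))
    (htop : Tendsto Φ atTop (𝓝 1)) (hlim : ∀ x, Tendsto (F · x) l (𝓝 (Φ x))) :
    TendstoUniformly F Φ l := by
  have hΦ0 : ∀ x, 0 ≤ Φ x := fun x => hmono.le_of_tendsto hbot x
  have hΦ1 : ∀ x, Φ x ≤ 1 := fun x => hmono.ge_of_tendsto htop x
  have hsurj : ∀ c, 0 < c → c < 1 → ∃ x, Φ x = c := fun c h0 h1 =>
    mem_range_of_exists_le_of_exists_ge hΦ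
      ((hbot.eventually (eventually_le_nhds h0)).exists)
      ((htop.eventually (eventually_ge_nhds h1)).exists)
  rw [Metric.tendstoUniformly_iff]
  intro ε hε
  -- The three parts of size `1 / k` are: rounding `Φ x` down to the grid, moving to a neighbouring
  -- quantile, and the pointwise error at that quantile.
  obtain ⟨k, hk⟩ := exists_nat_gt (3 / ε)
  have hk0 : (0 : ℝ) < k := lt_trans (by positivity) hk
  have hkε : 3 / (k : ℝ) < ε := by
    rw [div_lt_iff₀ hk0]; rw [div_lt_iff₀ hε] at hk; linarith
  have hq : ∀ j : ℕ, ∃ x, 0 < j → j < k → Φ x = j / k := by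
    intro j
    by_cases hj : 0 < j ∧ j < k
    · obtain ⟨x, hx⟩ := hsurj (j / k) (by have := hj.1; positivity)
        (by rw [div_lt_one hk0]; exact_mod_cast hj.2)
      exact ⟨x, fun _ _ => hx⟩
    · exact ⟨0, fun h1 h2 => absurd ⟨h1, h2⟩ hj⟩
  choose q hq using hq
  have hev : ∀ᶠ i in l, ∀ j ∈ Finset.range k, |F i (q j) - Φ (q j)| < 1 / k := by
    rw [Filter.eventually_all_finset]
    intro j _
    have := (Metric.tendsto_nhds.1 (hlim (q j))) (1 / k) (by positivity)
    simpa [Real.dist_eq] using this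
  filter_upwards [hev] with i hi x
  have hkΦ : 0 ≤ k * Φ x := mul_nonneg hk0.le (hΦ0 x)
  have hf1 := Nat.floor_le hkΦ
  have hf2 := Nat.lt_floor_add_one (k * Φ x)
  set j := ⌊k * Φ x⌋₊ with hj
  have hle1 : (j : ℝ) / k ≤ Φ x := by rw [div_le_iff₀ hk0]; linarith
  have hlt1 : Φ x < (j + 1 : ℝ) / k := by rw [lt_div_iff₀ hk0]; linarith
  have hsplit : (j + 1 : ℝ) / k = j / k + 1 / k := by ring
  have h3k : 3 / (k : ℝ) = 1 / k + 1 / k + 1 / k := by ring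
  have hkpos : 0 < 1 / (k : ℝ) := by positivity
  have hupper : F i x ≤ Φ x + 3 / k := by
    by_cases hjk : j + 1 < k
    · have hqj := hq (j + 1) (Nat.succ_pos _) hjk
      have hxq : x ≤ q (j + 1) := by
        by_contra hcon
        have := hmono (not_le.1 hcon).le
        rw [hqj] at this
        push_cast at this
        linarith
      have h1 := hF i hxq
      have h2 := (abs_lt.1 (hi (j + 1) (Finset.mem_range.2 hjk))).2
      rw [hqj] at h2
      push_cast at h2
      linarith
    · have hjk' : (k : ℝ) ≤ j + 1 := by exact_mod_cast not_lt.1 hjk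
      have : 1 ≤ (j + 1 : ℝ) / k := by rw [le_div_iff₀ hk0]; linarith
      have := hF1 i x
      linarith
  have hlower : Φ x - 3 / k ≤ F i x := by
    -- The quantile of index `j - 1` is used because `Φ (q j) ≤ Φ x` would not give `q j ≤ x` where
    -- `Φ` is flat; the strict gap does.
    rcases Nat.eq_zero_or_pos (j - 1) with hj0 | hj0
    · have : (j : ℝ) ≤ 1 := by
        have : j ≤ 1 := by omega
        exact_mod_cast this
      have : (j : ℝ) / k ≤ 1 / k := by gcongr
      have := hF0 i x
      linarith
    · have hjk : j ≤ k := by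
        have : (j : ℝ) ≤ k := hf1.trans (by nlinarith [hΦ1 x])
        exact_mod_cast this
      have hjk' : j - 1 < k := by omega
      have hqj := hq (j - 1) hj0 hjk'
      have hc : ((j - 1 : ℕ) : ℝ) = j - 1 := by
        rw [Nat.cast_sub (by omega)]; simp
      rw [hc] at hqj
      have hs : ((j : ℝ) - 1) / k = j / k - 1 / k := by ring
      have hxq : q (j - 1) ≤ x := by
        by_contra hcon
        have := hmono (not_le.1 hcon).le
        linarith
      have h1 := hF i hxq
      have h2 := (abs_lt.1 (hi (j - 1) (Finset.mem_range.2 hjk'))).1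
      linarith
  rw [Real.dist_eq, abs_lt]
  constructor <;> linarith

/-! ### Symmetric stable laws: absence of atoms, reflection and centring -/

/-- A finite measure whose characteristic function vanishes at infinity has no atom at the
origin. -/
theorem measureReal_singleton_zero_of_tendsto_charFun {G : Measure ℝ} [IsFiniteMeasure G]
    (h : Tendsto (fun t : ℝ => charFun G t) (cocompact ℝ) (𝓝 0)) : G.real {0} = 0 := by
  -- The mean of the characteristic function over `[-r, r]` is `∫ sinc (r x) dG`. As `r → ∞` the
  -- latter tends to the mass at `0`, the former to `0`.
  have hsinc : Tendsto (fun n : ℕ => ∫ x, Real.sinc ((n + 1 : ℝ) * x) ∂G) atTop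
      (𝓝 (∫ x, Set.indicator {0} (fun _ => (1 : ℝ)) x ∂G)) := by
    refine tendsto_integral_of_dominated_convergence (fun _ => 1) (fun n => ?_) (by fun_prop)
      (fun n => ?_) ?_
    · exact (Real.measurable_sinc.comp (measurable_const_mul _)).aestronglyMeasurable
    · exact Eventually.of_forall fun x => by
        simpa using Real.abs_sinc_le_one _
    · refine Eventually.of_forall fun x => ?_
      by_cases hx : x = 0
      · simp [hx]
      · have hx' : 0 < |x| := abs_pos.2 hx
        simp only [Set.indicator, Set.mem_singleton_iff, hx, if_false]
        have hlim : Tendsto (fun n : ℕ => ((n + 1 : ℝ) * |x|)⁻¹) atTop (𝓝 0) :=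
          tendsto_inv_atTop_zero.comp
            ((tendsto_natCast_atTop_atTop.atTop_add tendsto_const_nhds).atTop_mul_const hx')
        refine squeeze_zero_norm (fun n => ?_) hlim
        have hne : (n + 1 : ℝ) * x ≠ 0 := mul_ne_zero (by positivity) hx
        rw [Real.sinc_of_ne_zero hne, norm_div, Real.norm_eq_abs, Real.norm_eq_abs, abs_mul,
          abs_of_nonneg (by positivity : (0 : ℝ) ≤ n + 1), div_eq_mul_inv]
        exact mul_le_of_le_one_left (by positivity) (Real.abs_sin_le_one _)
  have hfun : ∀ n : ℕ, ((∫ x, Real.sinc ((n + 1 : ℝ) * x) ∂G : ℝ) : ℂ) =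
      ∫ t in Set.Ioc (-1 : ℝ) 1, (2 : ℂ)⁻¹ * charFun G ((n + 1 : ℝ) * t) := by
    intro n
    have hn : (0 : ℝ) < n + 1 := by positivity
    have h1 := integral_charFun_Icc (μ := G) hn
    have h2 := intervalIntegral.integral_comp_mul_left (a := -1) (b := 1) (charFun G) hn.ne'
    rw [← intervalIntegral.integral_of_le (by norm_num), intervalIntegral.integral_const_mul, h2]
    simp only [mul_neg, mul_one]
    rw [h1]
    have : ((n + 1 : ℝ) : ℂ) ≠ 0 := by exact_mod_cast hn.ne'
    rw [Complex.real_smul]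
    push_cast at this ⊢
    field_simp
  have hzero : Tendsto (fun n : ℕ => ∫ t in Set.Ioc (-1 : ℝ) 1,
      (2 : ℂ)⁻¹ * charFun G ((n + 1 : ℝ) * t)) atTop (𝓝 (∫ t in Set.Ioc (-1 : ℝ) 1, 0)) := by
    refine tendsto_integral_of_dominated_convergence (fun _ => 2⁻¹ * G.real Set.univ)
      (fun n => ?_) (by fun_prop) (fun n => ?_) ?_
    · have : Measurable (charFun G) := by fun_prop
      exact ((this.comp (measurable_const_mul _)).const_mul _).aestronglyMeasurable
    · refine Eventually.of_forall fun t => ?_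
      rw [norm_mul]
      have := norm_charFun_le (μ := G) ((n + 1 : ℝ) * t)
      simpa using this
    · refine ae_restrict_of_ae ?_
      have : ∀ᵐ t : ℝ, t ≠ 0 := by simp [ae_iff]
      filter_upwards [this] with t ht
      have hc : Tendsto (fun n : ℕ => (n + 1 : ℝ) * t) atTop (cocompact ℝ) := by
        rw [← Metric.cobounded_eq_cocompact, ← comap_norm_atTop, tendsto_comap_iff]
        simp only [Function.comp_def]
        simp only [norm_mul]
        refine Tendsto.atTop_mul_const (norm_pos_iff.2 ht) ?_
        refine tendsto_norm_atTop_atTop.comp ?_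
        exact tendsto_natCast_atTop_atTop.atTop_add tendsto_const_nhds
      simpa using (h.comp hc).const_mul (2 : ℂ)⁻¹
  have hC := (Complex.continuous_ofReal.tendsto _).comp hsinc
  have := tendsto_nhds_unique (hC.congr fun n => by
    exact hfun n) hzero
  rw [integral_indicator_const _ (measurableSet_singleton _)] at this
  simpa using this

/-- A probability measure whose characteristic function vanishes at infinity has no atoms. -/
theorem nullSingletonClass_of_tendsto_charFun {G : Measure ℝ} [IsProbabilityMeasure G]
    (h : Tendsto (fun t : ℝ => charFun G t) (cocompact ℝ) (𝓝 0)) : NullSingletonClass G := by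
  refine ⟨fun x => ?_⟩
  have : IsProbabilityMeasure (G.map (· + -x)) :=
    Measure.isProbabilityMeasure_map (by fun_prop)
  have h0 : (G.map (· + -x)).real {0} = 0 := by
    refine measureReal_singleton_zero_of_tendsto_charFun ?_
    rw [tendsto_zero_iff_norm_tendsto_zero] at h ⊢
    refine h.congr fun t => ?_
    rw [charFun_map_add_const, norm_mul, Complex.norm_exp_ofReal_mul_I, mul_one]
  rw [map_measureReal_apply (by fun_prop) (measurableSet_singleton _)] at h0
  have hs : (fun y : ℝ => y + -x) ⁻¹' {0} = {x} := by
    ext y; simp [← sub_eq_add_neg, sub_eq_zero]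
  rw [hs] at h0
  exact (measureReal_eq_zero_iff).1 h0

theorem continuous_cdf {G : Measure ℝ} [IsProbabilityMeasure G] [NullSingletonClass G] :
    Continuous (cdf G) := by
  rw [continuous_iff_continuousAt]
  intro x
  rw [(cdf G).mono.continuousAt_iff_leftLim_eq_rightLim, StieltjesFunction.rightLim_eq]
  have h := (cdf G).measure_singleton x
  rw [measure_cdf, measure_singleton, eq_comm, ENNReal.ofReal_eq_zero, sub_nonpos] at h
  exact le_antisymm ((cdf G).mono.leftLim_le le_rfl) h

theorem IsSymmStable.nullSingletonClass {α σ μ : ℝ} {G : Measure ℝ} (hα : 0 < α) (hσ : 0 < σ)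
    (hG : IsSymmStable α σ μ G) : NullSingletonClass G := by
  have := hG.isProbabilityMeasure
  refine nullSingletonClass_of_tendsto_charFun ?_
  rw [tendsto_zero_iff_norm_tendsto_zero]
  have h1 : Tendsto (fun t : ℝ => σ ^ α * |t| ^ α) (cocompact ℝ) atTop := by
    refine Tendsto.const_mul_atTop (by positivity) ((tendsto_rpow_atTop hα).comp ?_)
    exact tendsto_norm_cocompact_atTop
  refine (Real.tendsto_exp_neg_atTop_nhds_zero.comp h1).congr fun t => ?_
  simp [hG.charFun_eq, Complex.norm_exp]

/-- The centred symmetric stable law is invariant under reflection. -/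
theorem IsSymmStable.map_neg {α σ : ℝ} {G : Measure ℝ} (hG : IsSymmStable α σ 0 G) :
    G.map (fun x => -x) = G := by
  have := hG.isProbabilityMeasure
  have : IsProbabilityMeasure (G.map (fun x => -x)) :=
    Measure.isProbabilityMeasure_map (by fun_prop)
  refine Measure.ext_of_charFun (funext fun t => ?_)
  have h := charFun_map_mul (μ := G) (-1) t
  simp only [neg_mul, one_mul] at h
  rw [h, hG.charFun_eq, hG.charFun_eq]
  simp

theorem IsSymmStable.measureReal_Ioi_neg {α σ : ℝ} {G : Measure ℝ} (hα : 0 < α) (hσ : 0 < σ)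
    (hG : IsSymmStable α σ 0 G) (x : ℝ) : G.real (Set.Ioi (-x)) = cdf G x := by
  have := hG.isProbabilityMeasure
  have := hG.nullSingletonClass hα hσ
  rw [cdf_eq_real, ← measureReal_congr Iio_ae_eq_Iic]
  conv_lhs => rw [← hG.map_neg, map_measureReal_apply measurable_neg measurableSet_Ioi]
  congr 1
  ext y
  simp

theorem IsSymmStable.map_sub_const {α σ μ : ℝ} {G : Measure ℝ} (hG : IsSymmStable α σ μ G) :
    IsSymmStable α σ 0 (G.map (fun x => x - μ)) := by
  have := hG.isProbabilityMeasure
  refine ⟨Measure.isProbabilityMeasure_map (by fun_prop), fun t => ?_⟩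
  simp only [sub_eq_add_neg]
  rw [charFun_map_add_const, hG.charFun_eq, ← Complex.exp_add]
  congr 1
  simp
  ring

/-- By reflection symmetry the integral equals its own negative, so integrability need not be known.
-/
theorem IsSymmStable.integral_sub_eq_zero {α σ μ : ℝ} {G : Measure ℝ}
    (hG : IsSymmStable α σ μ G) : ∫ x, (x - μ) ∂G = 0 := by
  have h1 : ∫ x, x ∂(G.map (fun x => x - μ)) = ∫ x, (x - μ) ∂G :=
    integral_map (by fun_prop) (by fun_prop)
  have h2 : ∫ x, x ∂((G.map (fun x => x - μ)).map (fun x => -x)) =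
      ∫ x, -x ∂(G.map (fun x => x - μ)) :=
    integral_map (by fun_prop) (by fun_prop)
  rw [hG.map_sub_const.map_neg, integral_neg] at h2
  linarith

/-! ### Central limit theorem under finite Mallows distance -/

/-- Interpolates between the quadratic bound for `|x| ≤ 1` and the linear bound for `|x| ≥ 1`. -/
theorem Complex.norm_exp_mul_I_sub_one_sub_le_rpow {α : ℝ} (h1 : 1 ≤ α) (h2 : α ≤ 2) (x : ℝ) :
    ‖Complex.exp (x * Complex.I) - 1 - x * Complex.I‖ ≤ 2 * |x| ^ α := by
  have hn : ‖(x : ℂ) * Complex.I‖ = |x| := by simp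
  rcases le_total |x| 1 with hx | hx
  · have h := Complex.norm_exp_sub_one_sub_id_le (x := x * Complex.I) (by rwa [hn])
    rw [hn] at h
    have h' : |x| ^ (2 : ℝ) ≤ |x| ^ α := by
      rcases (abs_nonneg x).eq_or_lt with h0 | h0
      · rw [← h0, Real.zero_rpow (by norm_num), Real.zero_rpow (by linarith)]
      · exact Real.rpow_le_rpow_of_exponent_ge h0 hx h2
    rw [Real.rpow_two] at h'
    have : 0 ≤ |x| ^ α := by positivity
    linarith
  · have h := Real.norm_exp_I_mul_ofReal_sub_one_le (x := x)
    rw [mul_comm, Real.norm_eq_abs] at h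
    have h' := Real.rpow_le_rpow_of_exponent_le hx h1
    rw [Real.rpow_one] at h'
    have := norm_sub_le (Complex.exp (x * Complex.I) - 1) (x * Complex.I)
    rw [hn] at this
    linarith

/-- The characteristic function of a centred random variable with finite moment of order
`α ∈ (1, 2)` is `1 + o(|u| ^ α)` at the origin. -/
theorem tendsto_nat_mul_charFun_sub_one {Ω' : Type*} [MeasurableSpace Ω'] {Q : Measure Ω'}
    [IsProbabilityMeasure Q] {Z : Ω' → ℝ} (hZ : Measurable Z) {α : ℝ} (h1 : 1 < α) (h2 : α < 2)
    (hint : Integrable Z Q) (h0 : ∫ ω, Z ω ∂Q = 0) (hmom : Integrable (fun ω => |Z ω| ^ α) Q)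
    (u : ℝ) :
    Tendsto (fun n : ℕ => (n : ℂ) * (charFun (Q.map Z) ((n : ℝ) ^ (-(1 / α)) * u) - 1)) atTop
      (𝓝 0) := by
  have hα : 0 < α := by linarith
  -- The linear term may be subtracted because `Z` is centred. The factor `n` then cancels against
  -- `(n ^ (-(1 / α))) ^ α`, so one multiple of `|Z| ^ α` dominates every `f n`.
  set f : ℕ → Ω' → ℂ := fun n ω => (n : ℂ) *
    (Complex.exp (((n : ℝ) ^ (-(1 / α)) * u * Z ω : ℝ) * Complex.I) - 1
      - ((n : ℝ) ^ (-(1 / α)) * u * Z ω : ℝ) * Complex.I) with hf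
  have hkey : ∀ n : ℕ, (n : ℂ) * (charFun (Q.map Z) ((n : ℝ) ^ (-(1 / α)) * u) - 1) =
      ∫ ω, f n ω ∂Q := by
    intro n
    simp only [hf]
    rw [integral_const_mul]
    congr 1
    rw [integral_sub, integral_sub, charFun_apply_real, integral_map (by fun_prop) (by fun_prop)]
    · have : ∫ ω, (((n : ℝ) ^ (-(1 / α)) * u * Z ω : ℝ) : ℂ) * Complex.I ∂Q = 0 := by
        rw [integral_mul_const, integral_complex_ofReal, integral_const_mul, h0]
        simp
      rw [this]
      simp
    · refine (integrable_const (1 : ℝ)).mono' (by fun_prop) (Eventually.of_forall fun ω => ?_)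
      rw [Complex.norm_exp_ofReal_mul_I]
    · exact integrable_const _
    · refine Integrable.sub ?_ (integrable_const _)
      refine (integrable_const (1 : ℝ)).mono' (by fun_prop) (Eventually.of_forall fun ω => ?_)
      rw [Complex.norm_exp_ofReal_mul_I]
    · exact ((hint.const_mul _).ofReal).mul_const _
  simp_rw [hkey]
  rw [show (0 : ℂ) = ∫ _ω, 0 ∂Q by simp]
  refine tendsto_integral_of_dominated_convergence (fun ω => 2 * |u| ^ α * |Z ω| ^ α)
    (fun n => by simp only [hf]; fun_prop) (hmom.const_mul _) (fun n => ?_) ?_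
  · refine Eventually.of_forall fun ω => ?_
    rcases Nat.eq_zero_or_pos n with rfl | hn
    · simp only [hf, CharP.cast_eq_zero, zero_mul, norm_zero]
      positivity
    have hn' : (0 : ℝ) < n := by exact_mod_cast hn
    simp only [hf]
    rw [norm_mul, Complex.norm_natCast]
    have h := Complex.norm_exp_mul_I_sub_one_sub_le_rpow h1.le h2.le
      ((n : ℝ) ^ (-(1 / α)) * u * Z ω)
    calc _ ≤ (n : ℝ) * (2 * |(n : ℝ) ^ (-(1 / α)) * u * Z ω| ^ α) := by gcongr
      _ = 2 * |u| ^ α * |Z ω| ^ α := by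
        rw [abs_mul, abs_mul, Real.mul_rpow (by positivity) (by positivity),
          Real.mul_rpow (by positivity) (by positivity), abs_of_nonneg (by positivity),
          ← Real.rpow_mul hn'.le]
        have : -(1 / α) * α = -1 := by field_simp
        rw [this, Real.rpow_neg_one]
        field_simp
  · refine Eventually.of_forall fun ω => ?_
    have hc : Tendsto (fun n : ℕ => (n : ℝ) ^ (-(1 / α)) * u * Z ω) atTop (𝓝 0) := by
      have := ((tendsto_rpow_neg_atTop (y := 1 / α) (by positivity)).comp
        tendsto_natCast_atTop_atTop).mul_const (u * Z ω)
      simpa [Function.comp_def, mul_assoc] using this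
    -- Pointwise the quadratic bound applies eventually and leaves `n * n ^ (-2 / α)`, which
    -- vanishes because `α < 2`.
    have hb : Tendsto (fun n : ℕ => (n : ℝ) ^ (-(2 / α - 1)) * (u * Z ω) ^ 2) atTop (𝓝 0) := by
      have := ((tendsto_rpow_neg_atTop (y := 2 / α - 1)
        (by rw [sub_pos, lt_div_iff₀ hα]; linarith)).comp
        tendsto_natCast_atTop_atTop).mul_const ((u * Z ω) ^ 2)
      simpa [Function.comp_def] using this
    refine squeeze_zero_norm' ?_ hb
    filter_upwards [(hc.abs).eventually (eventually_le_nhds (b := (1 : ℝ)) (by simp)),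
      eventually_gt_atTop 0] with n hn hn0
    have hn' : (0 : ℝ) < n := by exact_mod_cast hn0
    have hnn : ‖(((n : ℝ) ^ (-(1 / α)) * u * Z ω : ℝ) : ℂ) * Complex.I‖ =
      |(n : ℝ) ^ (-(1 / α)) * u * Z ω| := by
        rw [norm_mul, Complex.norm_I, mul_one, Complex.norm_real, Real.norm_eq_abs]
    have h := Complex.norm_exp_sub_one_sub_id_le (hnn.trans_le hn)
    simp only [hf]
    rw [norm_mul, Complex.norm_natCast]
    refine (mul_le_mul_of_nonneg_left h hn'.le).trans_eq ?_
    rw [hnn, sq_abs, mul_assoc, mul_pow, ← Real.rpow_natCast (_ ^ _) 2, ← Real.rpow_mul hn'.le]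
    have : (-(2 / α - 1)) = 1 + (-(1 / α) * (2 : ℕ)) := by push_cast; ring
    rw [this, Real.rpow_add hn', Real.rpow_one]
    ring

theorem norm_pow_sub_one_le {z : ℂ} (hz : ‖z‖ ≤ 1) (n : ℕ) : ‖z ^ n - 1‖ ≤ n * ‖z - 1‖ := by
  induction n with
  | zero => simp
  | succ n ih =>
    have h : z ^ (n + 1) - 1 = z ^ n * (z - 1) + (z ^ n - 1) := by ring
    rw [h]
    refine (norm_add_le _ _).trans ?_
    rw [norm_mul, norm_pow]
    have : ‖z‖ ^ n * ‖z - 1‖ ≤ 1 * ‖z - 1‖ := by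
      gcongr; exact pow_le_one₀ (norm_nonneg _) hz
    push_cast
    linarith

/-- The integrands differ in modulus by `|exp (i u (A - B)) - 1|`, whose square is `2 (1 - cos (u (A
- B)))`; Cauchy–Schwarz, in the form of a nonnegative variance, finishes. -/
theorem norm_charFun_sub_charFun_sq_le {Ω' : Type*} [MeasurableSpace Ω'] {Q : Measure Ω'}
    [IsProbabilityMeasure Q] {A B : Ω' → ℝ} (hA : Measurable A) (hB : Measurable B) (u : ℝ) :
    ‖charFun (Q.map A) u - charFun (Q.map B) u‖ ^ 2 ≤
      2 * ‖charFun (Q.map (fun ω => A ω - B ω)) u - 1‖ := by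
  have hi : ∀ {C : Ω' → ℝ}, Measurable C →
      Integrable (fun ω => Complex.exp (u * C ω * Complex.I)) Q := fun {C} hC => by
    refine (integrable_const (1 : ℝ)).mono' (by fun_prop) (Eventually.of_forall fun ω => ?_)
    rw [← Complex.ofReal_mul, Complex.norm_exp_ofReal_mul_I]
  have hchar : ∀ {C : Ω' → ℝ}, Measurable C →
      charFun (Q.map C) u = ∫ ω, Complex.exp (u * C ω * Complex.I) ∂Q := fun {C} hC => by
    rw [charFun_apply_real, integral_map (by fun_prop) (by fun_prop)]
  have hAB : Measurable fun ω => A ω - B ω := hA.sub hB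
  set f : Ω' → ℝ := fun ω => ‖Complex.exp (u * (A ω - B ω : ℝ) * Complex.I) - 1‖ with hf
  have hfm : Measurable f := by fun_prop
  have hf2 : ∀ ω, f ω ≤ 2 := fun ω => by
    refine (norm_sub_le _ _).trans ?_
    rw [← Complex.ofReal_mul, Complex.norm_exp_ofReal_mul_I]
    norm_num
  have hfL : MemLp f 2 Q := MemLp.of_bound hfm.aestronglyMeasurable 2
    (Eventually.of_forall fun ω => by
      rw [Real.norm_eq_abs, abs_of_nonneg (norm_nonneg _)]; exact hf2 ω)
  have hstep : ‖charFun (Q.map A) u - charFun (Q.map B) u‖ ≤ ∫ ω, f ω ∂Q := by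
    rw [hchar hA, hchar hB, ← integral_sub (hi hA) (hi hB)]
    refine (norm_integral_le_integral_norm _).trans_eq (integral_congr_ae ?_)
    refine Eventually.of_forall fun ω => ?_
    have : Complex.exp (u * A ω * Complex.I) - Complex.exp (u * B ω * Complex.I) =
        Complex.exp ((u * B ω : ℝ) * Complex.I) *
          (Complex.exp (u * (A ω - B ω : ℝ) * Complex.I) - 1) := by
      rw [mul_sub, ← Complex.exp_add, mul_one]
      push_cast
      congr 2
      ring
    simp only [hf]
    rw [this, norm_mul, Complex.norm_exp_ofReal_mul_I, one_mul]
  have hsq : (∫ ω, f ω ∂Q) ^ 2 ≤ ∫ ω, f ω ^ 2 ∂Q := by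
    have h1 := variance_nonneg f Q
    rw [variance_eq_sub hfL] at h1
    simpa using h1
  have hre : ∫ ω, f ω ^ 2 ∂Q = 2 * (1 - charFun (Q.map (fun ω => A ω - B ω)) u).re := by
    have hfe : ∀ ω, f ω ^ 2 = 2 * (1 - (Complex.exp (u * (A ω - B ω : ℝ) * Complex.I)).re) := by
      intro ω
      simp only [hf]
      rw [← Complex.ofReal_mul, ← Complex.normSq_eq_norm_sq, Complex.normSq_apply]
      simp only [Complex.sub_re, Complex.sub_im, Complex.exp_ofReal_mul_I_re,
        Complex.exp_ofReal_mul_I_im, Complex.one_re, Complex.one_im]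
      nlinarith [Real.sin_sq_add_cos_sq (u * (A ω - B ω))]
    have hre' : Integrable
        (fun ω => (Complex.exp (u * (A ω - B ω : ℝ) * Complex.I)).re) Q := (hi hAB).re
    simp_rw [hfe]
    rw [integral_const_mul, integral_sub (integrable_const _) hre', hchar hAB]
    congr 1
    rw [Complex.sub_re, Complex.one_re]
    congr 1
    · simp
    · exact integral_re (hi hAB)
  calc _ ≤ (∫ ω, f ω ∂Q) ^ 2 := by gcongr
    _ ≤ 2 * (1 - charFun (Q.map (fun ω => A ω - B ω)) u).re := hsq.trans_eq hre
    _ ≤ _ := by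
      rw [norm_sub_rev]
      gcongr
      exact Complex.re_le_norm _

theorem charFun_pi_map_sum {Ω' : Type*} [MeasurableSpace Ω'] {Q : Measure Ω'}
    [IsProbabilityMeasure Q] {A : Ω' → ℝ} (hA : Measurable A) (n : ℕ) (u : ℝ) :
    charFun ((Measure.pi fun _ : Fin n => Q).map (fun p => ∑ i, A (p i))) u =
      charFun (Q.map A) u ^ n := by
  have h := (iIndepFun_pi (μ := fun _ : Fin n => Q) (X := fun _ => A)
    fun _ => hA.aemeasurable).charFun_map_fun_sum_eq_prod
      (fun i => (hA.comp (measurable_pi_apply i)).aemeasurable)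
  simp only [Function.comp_def] at h
  rw [h]
  simp only [Finset.prod_apply]
  have : ∀ i : Fin n, (Measure.pi fun _ : Fin n => Q).map (fun p => A (p i)) = Q.map A := by
    intro i
    have h := (measurePreserving_eval (fun _ : Fin n => Q) i).map_eq
    conv_rhs => rw [← h, Measure.map_map hA (measurable_pi_apply i)]
    rfl
  simp [this]

/-- The preceding inequality applied to sums over `n` independent copies of the coupled pair.
Comparing sums rather than single summands keeps the bound useful after taking `n`-th powers. -/
theorem norm_charFun_pow_sub_charFun_pow_sq_le {Ω' : Type*} [MeasurableSpace Ω'] {Q : Measure Ω'}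
    [IsProbabilityMeasure Q] {A B : Ω' → ℝ} (hA : Measurable A) (hB : Measurable B) (n : ℕ)
    (u : ℝ) :
    ‖charFun (Q.map A) u ^ n - charFun (Q.map B) u ^ n‖ ^ 2 ≤
      2 * ‖charFun (Q.map (fun ω => A ω - B ω)) u ^ n - 1‖ := by
  have h := norm_charFun_sub_charFun_sq_le (Q := Measure.pi fun _ : Fin n => Q)
    (A := fun p => ∑ i, A (p i)) (B := fun p => ∑ i, B (p i)) (by fun_prop) (by fun_prop) u
  simp_rw [← Finset.sum_sub_distrib] at h
  have hAB : Measurable fun ω => A ω - B ω := hA.sub hB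
  rwa [charFun_pi_map_sum hA, charFun_pi_map_sum hB, charFun_pi_map_sum hAB] at h

theorem charFun_map_mul_partialSum_sub {Ω : Type*} [MeasurableSpace Ω] {P : Measure Ω}
    [IsProbabilityMeasure P] {X : ℕ → Ω → ℝ} (hX : ∀ j, Measurable (X j)) (hindep : iIndepFun X P)
    (hident : ∀ j, IdentDistrib (X j) (X 0) P P) (n : ℕ) (c m u : ℝ) :
    charFun (P.map (fun ω => c * (partialSum X n ω - n * m))) u =
      charFun (P.map (fun ω => X 0 ω - m)) (c * u) ^ n := by
  have hs : ∀ ω, partialSum X n ω - n * m = ∑ k ∈ Finset.range n, (X k ω - m) := fun ω => by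
    simp [partialSum]
  simp_rw [hs]
  have hind : iIndepFun (fun k ω => X k ω - m) P :=
    hindep.comp (fun _ x => x - m) (by fun_prop)
  rw [charFun_map_mul_comp (by fun_prop),
    (hind.restrict _).charFun_map_fun_finsetSum_eq_prod (fun _ _ => by fun_prop)]
  have hmap : ∀ k, P.map (fun ω => X k ω - m) = P.map (fun ω => X 0 ω - m) := fun k =>
    ((hident k).comp (u := fun x => x - m) (by fun_prop)).map_eq
  simp [hmap]

/-- A finite infimum only requires some coupling of finite cost; optimality is never used. -/
theorem exists_coupling_of_mallowsDist_lt_top {r : ℝ} (hr : 0 < r) {F G : Measure ℝ}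
    (h : mallowsDist r F G < ∞) :
    ∃ π : Measure (ℝ × ℝ), π.map Prod.fst = F ∧ π.map Prod.snd = G ∧
      MemLp (fun p : ℝ × ℝ => p.1 - p.2) (ENNReal.ofReal r) π := by
  simp only [mallowsDist, iInf_lt_iff] at h
  obtain ⟨π, ⟨h1, h2⟩, h3⟩ := h
  refine ⟨π, h1, h2, ?_⟩
  rw [ENNReal.rpow_lt_top_iff_of_pos (by positivity)] at h3
  refine ⟨by fun_prop, ?_⟩
  rw [eLpNorm_lt_top_iff_lintegral_rpow_enorm_lt_top (by simpa using hr) (by simp),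
    ENNReal.toReal_ofReal hr.le]
  refine lt_of_eq_of_lt (lintegral_congr fun p => ?_) h3
  rw [← ENNReal.ofReal_rpow_of_nonneg (abs_nonneg _) hr.le, Real.enorm_eq_ofReal_abs]

/-- Central limit theorem in the domain of normal attraction of a symmetric stable law: the
summands are within finite Mallows distance of the stable law. -/
theorem tendsto_charFun_partialSum_of_mallowsDist {Ω : Type*} [MeasurableSpace Ω] {P : Measure Ω}
    [IsProbabilityMeasure P] {X : ℕ → Ω → ℝ} (hX : ∀ j, Measurable (X j)) (hindep : iIndepFun X P)
    (hident : ∀ j, IdentDistrib (X j) (X 0) P P) {α σ μ : ℝ} (hα : 1 < α) (hα2 : α < 2)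
    {G : Measure ℝ} (hG : IsSymmStable α σ μ G)
    (hd : mallowsDist α (P.map (X 0)) G < ∞) (hint : Integrable (X 0) P) (u : ℝ) :
    Tendsto (fun n : ℕ => charFun
      (P.map (fun ω => (n : ℝ) ^ (-(1 / α)) * (partialSum X n ω - n * ∫ ω, X 0 ω ∂P))) u) atTop
      (𝓝 (charFun (G.map (fun x => x - μ)) u)) := by
  have hα0 : 0 < α := by linarith
  have := hG.isProbabilityMeasure
  have hPX : IsProbabilityMeasure (P.map (X 0)) :=
    Measure.isProbabilityMeasure_map (hX 0).aemeasurable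
  obtain ⟨π, h1, h2, hD⟩ := exists_coupling_of_mallowsDist_lt_top hα0 hd
  have hπ : IsProbabilityMeasure π := by
    have : IsProbabilityMeasure (π.map Prod.fst) := h1 ▸ hPX
    exact Measure.isProbabilityMeasure_of_map Prod.fst
  set m := ∫ ω, X 0 ω ∂P with hm
  set A : ℝ × ℝ → ℝ := fun p => p.1 - m with hA
  set B : ℝ × ℝ → ℝ := fun p => p.2 - μ with hB
  have hAm : Measurable A := by fun_prop
  have hBm : Measurable B := by fun_prop
  have hmapA : P.map (fun ω => X 0 ω - m) = π.map A := by
    rw [show A = (fun x => x - m) ∘ Prod.fst from rfl,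
      ← Measure.map_map (by fun_prop) measurable_fst, h1, Measure.map_map (by fun_prop) (hX 0)]
    rfl
  have hmapB : G.map (fun x => x - μ) = π.map B := by
    rw [show B = (fun x => x - μ) ∘ Prod.snd from rfl,
      ← Measure.map_map (by fun_prop) measurable_snd, h2]
  have hDint : Integrable (fun p : ℝ × ℝ => p.1 - p.2) π :=
    hD.integrable (by rw [← ENNReal.ofReal_one]; exact ENNReal.ofReal_le_ofReal hα.le)
  have hint1 : Integrable (fun p : ℝ × ℝ => p.1) π := by
    have : Integrable (fun x : ℝ => x) (π.map Prod.fst) := by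
      rw [h1]
      exact (integrable_map_measure (by fun_prop) (hX 0).aemeasurable).2 hint
    exact this.comp_measurable measurable_fst
  have hint2 : Integrable (fun p : ℝ × ℝ => p.2) π := by
    exact (hint1.sub hDint).congr (Eventually.of_forall fun p => by simp)
  have hA0 : ∫ p, A p ∂π = 0 := by
    have h : ∫ x, (x - m) ∂(π.map Prod.fst) = ∫ p, A p ∂π :=
      integral_map (by fun_prop) (by fun_prop)
    rw [← h, h1, integral_map (hX 0).aemeasurable (by fun_prop),
      integral_sub hint (integrable_const _)]
    simp [hm]
  have hB0 : ∫ p, B p ∂π = 0 := by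
    have h : ∫ x, (x - μ) ∂(π.map Prod.snd) = ∫ p, B p ∂π :=
      integral_map (by fun_prop) (by fun_prop)
    rw [← h, h2, hG.integral_sub_eq_zero]
  have hAi : Integrable A π := hint1.sub (integrable_const _)
  have hBi : Integrable B π := hint2.sub (integrable_const _)
  have hmom : Integrable (fun p => |A p - B p| ^ α) π := by
    have hL : MemLp (fun p => A p - B p) (ENNReal.ofReal α) π := by
      refine (hD.sub (memLp_const (m - μ))).ae_eq (Eventually.of_forall fun p => ?_)
      simp only [Pi.sub_apply, hA, hB]
      ring
    have := hL.integrable_norm_rpow (by simpa using hα0) (by simp)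
    rwa [ENNReal.toReal_ofReal hα0.le] at this
  have hZ := tendsto_nat_mul_charFun_sub_one (Q := π) (Z := fun p => A p - B p) (hAm.sub hBm)
    hα hα2 (hAi.sub hBi) (by rw [integral_sub hAi hBi, hA0, hB0, sub_zero]) hmom u
  -- Strict stability of the centred law: its normalized sums have the same law for every `n`.
  have hstable : ∀ n : ℕ, 0 < n → charFun (π.map B) ((n : ℝ) ^ (-(1 / α)) * u) ^ n =
      charFun (π.map B) u := by
    intro n hn
    have hn' : (0 : ℝ) < n := by exact_mod_cast hn
    rw [← hmapB, hG.map_sub_const.charFun_eq, hG.map_sub_const.charFun_eq, ← Complex.exp_nat_mul]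
    congr 1
    rw [abs_mul, abs_of_nonneg (by positivity : 0 ≤ (n : ℝ) ^ (-(1 / α))),
      Real.mul_rpow (by positivity) (by positivity), ← Real.rpow_mul hn'.le]
    have : -(1 / α) * α = -1 := by field_simp
    rw [this, Real.rpow_neg_one]
    have hn'' : (n : ℂ) ≠ 0 := by exact_mod_cast hn.ne'
    push_cast
    field_simp
    simp
  rw [hmapB]
  simp_rw [charFun_map_mul_partialSum_sub hX hindep hident]
  rw [hmapA, tendsto_iff_norm_sub_tendsto_zero]
  have hsq : Tendsto (fun n : ℕ => ‖charFun (π.map A) ((n : ℝ) ^ (-(1 / α)) * u) ^ n -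
      charFun (π.map B) u‖ ^ 2) atTop (𝓝 0) := by
    have hZ' := hZ.norm.const_mul 2
    rw [norm_zero, mul_zero] at hZ'
    refine squeeze_zero' (Eventually.of_forall fun n => by positivity) ?_ hZ'
    filter_upwards [eventually_gt_atTop 0] with n hn
    rw [← hstable n hn]
    refine (norm_charFun_pow_sub_charFun_pow_sq_le hAm hBm n _).trans ?_
    have : IsProbabilityMeasure (π.map fun p => A p - B p) :=
      Measure.isProbabilityMeasure_map (by fun_prop)
    rw [norm_mul, Complex.norm_natCast]
    gcongr
    exact norm_pow_sub_one_le (norm_charFun_le_one _) n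
  have := hsq.sqrt
  simpa [Real.sqrt_sq] using this

theorem isSymmStable_gaussianReal (v : ℝ≥0) : IsSymmStable 2 (√v / √2) 0 (gaussianReal 0 v) := by
  refine ⟨inferInstance, fun t => ?_⟩
  rw [charFun_gaussianReal]
  congr 1
  rw [Real.rpow_two, Real.rpow_two, div_pow, Real.sq_sqrt (by positivity),
    Real.sq_sqrt (by positivity), sq_abs]
  push_cast
  ring

/-- A law at finite Mallows distance of order `2` from a normal law has a second moment. -/
theorem memLp_two_of_mallowsDist {Ω : Type*} [MeasurableSpace Ω] {P : Measure Ω} {Y : Ω → ℝ}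
    (hY : Measurable Y) {σ μ : ℝ} {G : Measure ℝ} (hG : IsSymmStable 2 σ μ G)
    (hd : mallowsDist 2 (P.map Y) G < ∞) : MemLp Y 2 P := by
  have := hG.isProbabilityMeasure
  have hGauss : G = gaussianReal μ (2 * σ ^ 2).toNNReal := by
    refine Measure.ext_of_charFun (funext fun t => ?_)
    rw [hG.charFun_eq, charFun_gaussianReal, Real.coe_toNNReal _ (by positivity)]
    congr 1
    rw [Real.rpow_two, Real.rpow_two, sq_abs]
    push_cast
    ring
  obtain ⟨π, h1, h2, hD⟩ := exists_coupling_of_mallowsDist_lt_top two_pos hd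
  have hL2 : MemLp (fun p : ℝ × ℝ => p.2) 2 π := by
    have : MemLp (fun x : ℝ => x) 2 (π.map Prod.snd) := by
      rw [h2, hGauss]; exact memLp_id_gaussianReal' 2 (by simp)
    exact this.comp_of_map measurable_snd.aemeasurable
  have hL1 : MemLp (fun p : ℝ × ℝ => p.1) 2 π := by
    have h := hD
    rw [ENNReal.ofReal_ofNat] at h
    refine (h.add hL2).ae_eq (Eventually.of_forall fun p => ?_)
    simp
  have h : MemLp (fun x : ℝ => x) 2 (P.map Y) := by
    rw [← h1]
    exact (memLp_map_measure_iff (by fun_prop) (by fun_prop)).2 hL1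
  exact h.comp_of_map hY.aemeasurable

theorem tendsto_charFun_partialSum_of_memLp_two {Ω : Type*} [MeasurableSpace Ω] {P : Measure Ω}
    [IsProbabilityMeasure P] {X : ℕ → Ω → ℝ} (hindep : iIndepFun X P)
    (hident : ∀ j, IdentDistrib (X j) (X 0) P P) (hL : MemLp (X 0) 2 P) (u : ℝ) :
    Tendsto (fun n : ℕ => charFun
      (P.map (fun ω => (n : ℝ) ^ (-(1 / 2 : ℝ)) * (partialSum X n ω - n * ∫ ω, X 0 ω ∂P))) u) atTop
      (𝓝 (charFun (gaussianReal 0 (variance (X 0) P).toNNReal) u)) := by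
  have h := (tendstoInDistribution_inv_sqrt_mul_sum_sub
    (P' := gaussianReal 0 (variance (X 0) P).toNNReal) (Y := id) HasLaw.id hL hindep hident).tendsto
  have h' := ProbabilityMeasure.tendsto_iff_tendsto_charFun.1 h u
  simp only [ProbabilityMeasure.coe_mk, Measure.map_id] at h'
  refine h'.congr fun n => ?_
  rw [Real.rpow_neg (by positivity), ← Real.sqrt_eq_rpow]
  rfl

/-- Convergence of characteristic functions to those of a symmetric stable law gives convergence
of the probabilities of exceeding the normalized levels. -/
theorem IsSymmStable.tendsto_measureReal_gt {Ω : Type*} [MeasurableSpace Ω] {P : Measure Ω}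
    [IsProbabilityMeasure P] {W : ℕ → Ω → ℝ} (hW : ∀ n, Measurable (W n)) {α σ : ℝ} (hα : 0 < α)
    (hσ : 0 < σ) {G : Measure ℝ} (hG : IsSymmStable α σ 0 G)
    (h : ∀ u, Tendsto (fun n => charFun (P.map (W n)) u) atTop (𝓝 (charFun G u))) (x : ℝ) :
    Tendsto (fun n => P.real {ω | -x < W n ω}) atTop (𝓝 (cdf G x)) := by
  have := hG.isProbabilityMeasure
  have := hG.nullSingletonClass hα hσ
  have hp : ∀ n, IsProbabilityMeasure (P.map (W n)) := fun n =>
    Measure.isProbabilityMeasure_map (hW n).aemeasurable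
  have hlim : Tendsto (β := ProbabilityMeasure ℝ) (fun n => ⟨P.map (W n), hp n⟩) atTop
      (𝓝 ⟨G, inferInstance⟩) := ProbabilityMeasure.tendsto_of_tendsto_charFun h
  have h1 := ProbabilityMeasure.tendsto_measure_of_null_frontier_of_tendsto' hlim
    (E := Set.Ioi (-x)) (by simp)
  have h2 := (ENNReal.tendsto_toReal (measure_ne_top G _)).comp h1
  rw [← hG.measureReal_Ioi_neg hα hσ]
  refine h2.congr fun n => ?_
  simp only [Function.comp_apply, ProbabilityMeasure.coe_mk]
  rw [Measure.map_apply (hW n) measurableSet_Ioi]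
  rfl

/-! ### First passage times in terms of partial sums -/

section Passage

variable {Ω : Type*} {X : ℕ → Ω → ℝ}

theorem cyclesToFailure_le_ofReal_iff {s t : ℝ} (ht : 0 ≤ t) {ω : Ω} :
    (cyclesToFailure X s ω : ℝ≥0∞) ≤ ENNReal.ofReal t ↔
      ∃ k, 1 ≤ k ∧ k ≤ ⌊t⌋₊ ∧ s < partialSum X k ω := by
  constructor
  · intro h
    -- A strict bound by the next integer lets the infimum yield a witness, which integrality brings
    -- back to at most `⌊t⌋₊`.
    have hlt : (cyclesToFailure X s ω : ℝ≥0∞) < ((⌊t⌋₊ + 1 : ℕ) : ℕ∞) := by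
      refine h.trans_lt ?_
      rw [ENat.toENNReal_coe, ← ENNReal.ofReal_natCast,
        ENNReal.ofReal_lt_ofReal_iff (by positivity)]
      push_cast
      exact Nat.lt_floor_add_one t
    rw [ENat.toENNReal_lt, cyclesToFailure] at hlt
    simp only [iInf_lt_iff] at hlt
    obtain ⟨k, ⟨hk1, hk2⟩, hk3⟩ := hlt
    exact ⟨k, hk1, Nat.lt_succ_iff.1 (by exact_mod_cast hk3), hk2⟩
  · rintro ⟨k, hk1, hk2, hk3⟩
    have h1 : cyclesToFailure X s ω ≤ k := iInf₂_le k ⟨hk1, hk3⟩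
    refine (ENat.toENNReal_le.2 h1).trans ?_
    rw [ENat.toENNReal_coe, ← ENNReal.ofReal_natCast]
    exact ENNReal.ofReal_le_ofReal ((Nat.le_floor_iff ht).1 hk2)

theorem fatigueLife_le_of_lt_partialSum {s t : ℝ} (ht : 0 ≤ t) {ω : Ω} {k : ℕ} (hk : k ≤ ⌊t⌋₊)
    (h : s < partialSum X k ω) : fatigueLife X s ω ≤ ENNReal.ofReal t := by
  have hd : damageAt X (k : ℝ≥0) ω = partialSum X k ω := by simp [damageAt]
  refine (iInf₂_le (k : ℝ≥0) (hd ▸ h)).trans ?_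
  rw [ENNReal.coe_natCast, ← ENNReal.ofReal_natCast]
  exact ENNReal.ofReal_le_ofReal ((Nat.le_floor_iff ht).1 hk)

/-- On a linear piece a value above `s` forces an endpoint above `s`. The right endpoint may come
after `t`, which costs one step. -/
theorem exists_lt_partialSum_of_fatigueLife_le {s t : ℝ} (hs : 0 < s) {ω : Ω}
    (h : fatigueLife X s ω ≤ ENNReal.ofReal t) :
    ∃ k, 1 ≤ k ∧ k ≤ ⌊t⌋₊ + 1 ∧ s < partialSum X k ω := by
  have hlt : fatigueLife X s ω < ENNReal.ofReal ((⌊t⌋₊ + 1 : ℕ) : ℝ) := by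
    refine h.trans_lt ?_
    rw [ENNReal.ofReal_lt_ofReal_iff (by positivity)]
    push_cast
    exact Nat.lt_floor_add_one t
  simp only [fatigueLife, iInf_lt_iff] at hlt
  obtain ⟨v, hv, hvt⟩ := hlt
  rw [ENNReal.ofReal_natCast, ← ENNReal.coe_natCast, ENNReal.coe_lt_coe] at hvt
  have hfl : ⌊v⌋₊ < ⌊t⌋₊ + 1 := (Nat.floor_lt (zero_le)).2 hvt
  have h0 : 0 ≤ (v : ℝ) - (⌊v⌋₊ : ℝ) := by
    rw [sub_nonneg]; exact_mod_cast Nat.floor_le (zero_le : 0 ≤ v)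
  have h1 : (v : ℝ) - (⌊v⌋₊ : ℝ) < 1 := by
    have : (v : ℝ) < ⌊v⌋₊ + 1 := by exact_mod_cast Nat.lt_floor_add_one v
    linarith
  have hsucc : partialSum X (⌊v⌋₊ + 1) ω = partialSum X ⌊v⌋₊ ω + X ⌊v⌋₊ ω := by
    simp [partialSum, Finset.sum_range_succ]
  rw [damageAt] at hv
  by_cases hp : s < partialSum X ⌊v⌋₊ ω
  · refine ⟨⌊v⌋₊, ?_, hfl.le, hp⟩
    rw [Nat.one_le_iff_ne_zero]
    intro h0
    rw [h0] at hp
    simp [partialSum] at hp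
    linarith
  · refine ⟨⌊v⌋₊ + 1, by omega, by omega, ?_⟩
    rw [hsucc]
    push Not at hp
    have hpos : 0 < X ⌊v⌋₊ ω := by
      by_contra hcon
      have := mul_nonpos_of_nonneg_of_nonpos h0 (not_lt.1 hcon)
      linarith
    nlinarith

end Passage

/-! ### Running maximum of a random walk with positive drift -/

theorem tendsto_measureReal_of_antitone {Ω : Type*} [MeasurableSpace Ω] {P : Measure Ω}
    [IsFiniteMeasure P] {E : ℕ → Set Ω} (hE : ∀ n, MeasurableSet (E n)) (hanti : Antitone E)
    (hempty : ∀ᵐ ω ∂P, ∃ n, ω ∉ E n) : Tendsto (fun n => P.real (E n)) atTop (𝓝 0) := by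
  have h := tendsto_measure_iInter_atTop (μ := P) (fun n => (hE n).nullMeasurableSet) hanti
    ⟨0, measure_ne_top _ _⟩
  have h0 : P (⋂ n, E n) = 0 := by
    refine measure_mono_null ?_ (ae_iff.1 hempty)
    intro ω hω
    simpa using hω
  rw [h0] at h
  have h' := (ENNReal.tendsto_toReal ENNReal.zero_ne_top).comp h
  rw [ENNReal.toReal_zero] at h'
  exact h'

section Walk

variable {Ω : Type*} [MeasurableSpace Ω] {P : Measure Ω} {X : ℕ → Ω → ℝ}

theorem measurable_partialSum (hX : ∀ j, Measurable (X j)) (n : ℕ) :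
    Measurable (partialSum X n) := by
  unfold partialSum
  fun_prop

/-- Reversing the order of the first `n` steps does not change their joint law. -/
theorem map_rev_eq (hX : ∀ j, Measurable (X j)) (hindep : iIndepFun X P)
    (hident : ∀ j, IdentDistrib (X j) (X 0) P P) (n : ℕ) :
    P.map (fun ω (i : Fin n) => X i.rev ω) = P.map (fun ω (i : Fin n) => X i ω) := by
  have h1 : iIndepFun (fun i : Fin n => X i) P := hindep.precomp Fin.val_injective
  have h2 : iIndepFun (fun i : Fin n => X i.rev) P :=
    hindep.precomp (g := fun i : Fin n => (i.rev : ℕ))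
      (Fin.val_injective.comp Fin.rev_injective)
  rw [h1.map_fun_eq_pi_map fun i => (hX _).aemeasurable,
    h2.map_fun_eq_pi_map fun i => (hX _).aemeasurable]
  congr 1
  funext i
  rw [(hident _).map_eq, (hident i).map_eq]

variable [IsProbabilityMeasure P]

/-- A random walk with positive drift is bounded below in probability. -/
theorem tendsto_measureReal_exists_partialSum_le_neg (hX : ∀ j, Measurable (X j))
    (hindep : iIndepFun X P) (hident : ∀ j, IdentDistrib (X j) (X 0) P P)
    (hmean : 0 < ∫ ω, X 0 ω ∂P) :
    Tendsto (fun K : ℕ => P.real {ω | ∃ j, partialSum X j ω ≤ -K}) atTop (𝓝 0) := by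
  have hint : Integrable (X 0) P := .of_integral_ne_zero hmean.ne'
  refine tendsto_measureReal_of_antitone (fun K => ?_) (fun K L hKL ω => ?_) ?_
  · rw [Set.ofPred_exists]
    exact MeasurableSet.iUnion fun j =>
      measurableSet_le (measurable_partialSum hX j) measurable_const
  · rintro ⟨j, hj⟩
    have : (K : ℝ) ≤ L := by exact_mod_cast hKL
    exact ⟨j, by linarith⟩
  -- By the strong law almost every path is eventually positive, so only finitely many sums can be
  -- negative and any `K` above the sum of their absolute values works.
  · filter_upwards [strong_law_ae_real X hint (fun i j hij => hindep.indepFun hij) hident]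
      with ω hω
    have hpos : ∀ᶠ n : ℕ in atTop, 0 < (∑ i ∈ Finset.range n, X i ω) / n :=
      hω.eventually (eventually_gt_nhds hmean)
    obtain ⟨N, hN⟩ := eventually_atTop.1 hpos
    obtain ⟨K, hK⟩ := exists_nat_gt (∑ j ∈ Finset.range N, |partialSum X j ω|)
    refine ⟨K, ?_⟩
    rintro ⟨j, hj⟩
    have hK0 : (0 : ℝ) ≤ ∑ j ∈ Finset.range N, |partialSum X j ω| := by positivity
    rcases lt_or_ge j N with hjN | hjN
    · have h1 := Finset.single_le_sum (f := fun j => |partialSum X j ω|)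
        (fun i _ => abs_nonneg _) (Finset.mem_range.2 hjN)
      have h2 := neg_abs_le (partialSum X j ω)
      linarith
    · have h1 := hN j hjN
      have h2 : partialSum X j ω / j ≤ 0 :=
        div_nonpos_of_nonpos_of_nonneg (by linarith) (by positivity)
      exact absurd h1 (not_lt.2 h2)

/-- Handles bounded `t` and large `s`: a maximum of finitely many finite variables is finite. -/
theorem tendsto_measureReal_exists_lt_partialSum (hX : ∀ j, Measurable (X j)) (n : ℕ) :
    Tendsto (fun s : ℕ => P.real {ω | ∃ k, 1 ≤ k ∧ k ≤ n ∧ (s : ℝ) < partialSum X k ω}) atTop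
      (𝓝 0) := by
  refine tendsto_measureReal_of_antitone (fun s => ?_) (fun s s' hs ω => ?_) ?_
  · rw [Set.ofPred_exists]
    refine MeasurableSet.iUnion fun k => ?_
    exact (MeasurableSet.const _).inter ((MeasurableSet.const _).inter
      (measurableSet_lt measurable_const (measurable_partialSum hX k)))
  · rintro ⟨k, h1, h2, h3⟩
    exact ⟨k, h1, h2, lt_of_le_of_lt (by exact_mod_cast hs) h3⟩
  · refine Eventually.of_forall fun ω => ?_
    obtain ⟨s, hs⟩ := exists_nat_gt (∑ j ∈ Finset.range (n + 1), |partialSum X j ω|)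
    refine ⟨s, ?_⟩
    rintro ⟨k, -, h2, h3⟩
    have h1 := Finset.single_le_sum (f := fun j => |partialSum X j ω|)
      (fun i _ => abs_nonneg _) (Finset.mem_range.2 (Nat.lt_succ_of_le h2))
    have := le_abs_self (partialSum X k ω)
    linarith

/-- Time reversal: `S_n - S_k` is the sum of the last `n - k` steps, so jointly in `k` these
differences have the law of the sums `S_{n-k}`. An excess of `K` over the endpoint becomes a descent
of the walk to `-K`. -/
theorem measureReal_exists_partialSum_add_le (hX : ∀ j, Measurable (X j))
    (hindep : iIndepFun X P) (hident : ∀ j, IdentDistrib (X j) (X 0) P P) (n : ℕ) (K : ℝ) :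
    P.real {ω | ∃ k, k ≤ n ∧ partialSum X n ω + K ≤ partialSum X k ω} ≤
      P.real {ω | ∃ j, partialSum X j ω ≤ -K} := by
  -- Expressed on the vector of steps, the event depends only on their joint law, which reversal
  -- preserves.
  set E : Set (Fin n → ℝ) :=
    {x | ∃ j, j ≤ n ∧ ∑ i : Fin n, (if (i : ℕ) < j then x i else 0) ≤ -K} with hE
  have hEm : MeasurableSet E := by
    rw [hE, Set.ofPred_exists]
    refine MeasurableSet.iUnion fun j => (MeasurableSet.const _).inter ?_
    have hterm : ∀ i : Fin n, Measurable fun x : Fin n → ℝ => if (i : ℕ) < j then x i else 0 := by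
      intro i
      split_ifs
      · exact measurable_pi_apply i
      · exact measurable_const
    exact measurableSet_le (Finset.measurable_fun_sum _ fun i _ => hterm i) measurable_const
  have hfwd : ∀ ω j, j ≤ n →
      ∑ i : Fin n, (if (i : ℕ) < j then X i ω else 0) = partialSum X j ω := by
    intro ω j hj
    rw [Fin.sum_univ_eq_sum_range (fun i => if i < j then X i ω else 0) n, ← Finset.sum_filter,
      partialSum]
    congr 1
    ext i
    simp only [Finset.mem_filter, Finset.mem_range]
    omega
  have hrev : ∀ ω j, j ≤ n →
      ∑ i : Fin n, (if (i : ℕ) < j then X i.rev ω else 0) =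
        partialSum X n ω - partialSum X (n - j) ω := by
    intro ω j hj
    rw [← hfwd ω n le_rfl, ← hfwd ω (n - j) (Nat.sub_le _ _), ← Finset.sum_sub_distrib]
    rw [← Equiv.sum_comp Fin.revPerm]
    refine Finset.sum_congr rfl fun i _ => ?_
    have hi := i.2
    simp only [Fin.revPerm_apply, Fin.val_rev, Fin.rev_rev, hi, if_true]
    by_cases hc : (i : ℕ) < n - j
    · rw [if_neg (by omega), if_pos hc, sub_self]
    · rw [if_pos (by omega), if_neg hc, sub_zero]
  calc _ ≤ P.real ((fun ω (i : Fin n) => X i.rev ω) ⁻¹' E) := by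
        refine measureReal_mono ?_
        rintro ω ⟨k, hk, h⟩
        refine ⟨n - k, Nat.sub_le _ _, ?_⟩
        simp only
        rw [hrev ω _ (Nat.sub_le _ _), Nat.sub_sub_self hk]
        linarith
    _ = P.real ((fun ω (i : Fin n) => X i ω) ⁻¹' E) := by
        rw [← map_measureReal_apply (measurable_pi_lambda _ fun i => hX _) hEm,
          map_rev_eq hX hindep hident,
          map_measureReal_apply (measurable_pi_lambda _ fun i => hX _) hEm]
    _ ≤ _ := by
        refine measureReal_mono ?_
        rintro ω ⟨j, hj, h⟩
        exact ⟨j, by rwa [← hfwd ω j hj]⟩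

/-- The probability that the running maximum exceeds `s`, in terms of the endpoint. -/
theorem measureReal_exists_lt_partialSum_le (hX : ∀ j, Measurable (X j))
    (hindep : iIndepFun X P) (hident : ∀ j, IdentDistrib (X j) (X 0) P P) (n : ℕ) (s K : ℝ) :
    P.real {ω | ∃ k, 1 ≤ k ∧ k ≤ n ∧ s < partialSum X k ω} ≤
      P.real {ω | s - K < partialSum X n ω} + P.real {ω | ∃ j, partialSum X j ω ≤ -K} := by
  refine le_trans ?_ (add_le_add_right
    (measureReal_exists_partialSum_add_le hX hindep hident n K) _)
  refine le_trans (measureReal_mono ?_) (measureReal_union_le _ _)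
  rintro ω ⟨k, -, hk, h⟩
  by_cases hc : s - K < partialSum X n ω
  · exact Or.inl hc
  · exact Or.inr ⟨k, hk, by linarith⟩

end Walk

/-! ### The generalized Birnbaum–Saunders law -/

theorem one_div_bsShape_mul_bsXi {α m s t : ℝ} (hm : 0 < m) (hs : 0 < s) (ht : 0 < t) :
    1 / bsShape α m s * bsXi α (t / bsScale m s) = (t * m - s) / t ^ (1 / α) := by
  have hx : t / bsScale m s = t * m / s := by rw [bsScale]; field_simp
  have h1 : 0 < t ^ (1 / α) := by positivity
  have h2 : 0 < m ^ (1 / α) := by positivity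
  have h3 : 0 < s ^ (1 / α) := by positivity
  rw [hx, bsShape, bsXi, Real.rpow_sub hs, Real.rpow_sub (by positivity), Real.rpow_one,
    Real.rpow_one, Real.div_rpow (by positivity) hs.le, Real.mul_rpow ht.le hm.le]
  field_simp

theorem strictMonoOn_standardized {α m s : ℝ} (hα : 1 < α) (hm : 0 < m) (hs : 0 < s) :
    StrictMonoOn (fun t : ℝ => (t * m - s) / t ^ (1 / α)) (Set.Ioi 0) := by
  have hp1 : 1 / α < 1 := by rw [div_lt_one (by linarith)]; exact hα
  have hp : 0 < 1 / α := by positivity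
  intro t ht t' ht' htt'
  simp only [Set.mem_Ioi] at ht ht'
  have hform : ∀ r : ℝ, 0 < r →
      (r * m - s) / r ^ (1 / α) = r ^ (1 - 1 / α) * m - s / r ^ (1 / α) := by
    intro r hr
    rw [Real.rpow_sub hr, Real.rpow_one]
    field_simp
  simp only
  rw [hform t ht, hform t' ht']
  have h1 : t ^ (1 - 1 / α) < t' ^ (1 - 1 / α) := Real.rpow_lt_rpow ht.le htt' (by linarith)
  have h2 : t ^ (1 / α) < t' ^ (1 / α) := Real.rpow_lt_rpow ht.le htt' hp
  have h3 : s / t' ^ (1 / α) < s / t ^ (1 / α) :=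
    div_lt_div_of_pos_left hs (by positivity) h2
  nlinarith

theorem surjOn_standardized {α m s : ℝ} (hα : 1 < α) (hm : 0 < m) (hs : 0 < s) :
    Set.univ ⊆ (fun t : ℝ => (t * m - s) / t ^ (1 / α)) '' (Set.Ioi 0) := by
  have hp1 : 1 / α < 1 := by rw [div_lt_one (by linarith)]; exact hα
  have hp : 0 < 1 / α := by positivity
  refine isPreconnected_Ioi.intermediate_value_Iii (l₁ := 𝓝[>] 0) (l₂ := atTop)
    inf_le_right (by simpa using Ioi_mem_atTop (0 : ℝ)) ?_ ?_ ?_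
  · refine ContinuousOn.div (by fun_prop) ?_ ?_
    · exact fun t ht => (Real.continuousAt_rpow_const _ _ (Or.inl (ne_of_gt ht))).continuousWithinAt
    · exact fun t ht => (Real.rpow_pos_of_pos ht _).ne'
  · have h1 : Tendsto (fun t : ℝ => t * m - s) (𝓝[>] 0) (𝓝 (0 * m - s)) :=
      ((continuous_id.mul continuous_const).sub continuous_const).continuousWithinAt.tendsto
    have h2 : Tendsto (fun t : ℝ => (t ^ (1 / α))⁻¹) (𝓝[>] 0) atTop := by
      refine tendsto_inv_nhdsGT_zero.comp (tendsto_nhdsWithin_iff.2 ⟨?_, ?_⟩)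
      · have := (Real.continuousAt_rpow_const 0 (1 / α) (Or.inr hp.le)).tendsto
        rw [Real.zero_rpow hp.ne'] at this
        exact this.mono_left nhdsWithin_le_nhds
      · filter_upwards [self_mem_nhdsWithin] with t ht
        exact Real.rpow_pos_of_pos ht _
    exact h1.neg_mul_atTop (by linarith) h2
  · have h1 : Tendsto (fun t : ℝ => t ^ (1 - 1 / α) * m) atTop atTop :=
      (tendsto_rpow_atTop (by linarith)).atTop_mul_const hm
    have h2 : Tendsto (fun t : ℝ => -s * t ^ (-(1 / α))) atTop (𝓝 (-s * 0)) :=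
      (tendsto_rpow_neg_atTop hp).const_mul _
    refine (h1.atTop_add h2).congr' ?_
    filter_upwards [eventually_gt_atTop 0] with t ht
    rw [Real.rpow_sub ht, Real.rpow_one, Real.rpow_neg ht.le]
    field_simp
    ring

/-- The generalized Birnbaum–Saunders distribution exists and is unique. -/
theorem existsUnique_bsCdf {G : Measure ℝ} [IsProbabilityMeasure G] {α m s : ℝ} (hα : 1 < α)
    (hm : 0 < m) (hs : 0 < s) :
    ∃! ν : Measure ℝ, IsProbabilityMeasure ν ∧ ν (Set.Iic 0) = 0 ∧
      ∀ t : ℝ, 0 < t → ν.real (Set.Iic t) = bsCdf G α m s t := by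
  have hmono := strictMonoOn_standardized hα hm hs
  have hinv : ∀ x : ℝ, ∃ t : ℝ, 0 < t ∧ (t * m - s) / t ^ (1 / α) = x := fun x =>
    surjOn_standardized hα hm hs (Set.mem_univ x)
  choose h hpos hval using hinv
  -- This equivalence identifies the c.d.f. of `G.map h` with `bsCdf` on `(0, ∞)`.
  have hle : ∀ x t : ℝ, 0 < t → (h x ≤ t ↔ x ≤ (t * m - s) / t ^ (1 / α)) := by
    intro x t ht
    conv_rhs => rw [← hval x]
    exact (hmono.le_iff_le (hpos x) ht).symm
  have hmonoh : Monotone h := fun x y hxy => (hle x _ (hpos y)).2 (hxy.trans_eq (hval y).symm)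
  refine ⟨G.map h, ⟨Measure.isProbabilityMeasure_map hmonoh.measurable.aemeasurable, ?_, ?_⟩, ?_⟩
  · rw [Measure.map_apply hmonoh.measurable measurableSet_Iic]
    have : h ⁻¹' Set.Iic 0 = ∅ := by
      ext x
      simpa using hpos x
    rw [this, measure_empty]
  · intro t ht
    rw [map_measureReal_apply hmonoh.measurable measurableSet_Iic, bsCdf,
      one_div_bsShape_mul_bsXi hm hs ht, cdf_eq_real]
    congr 1
    ext x
    exact hle x t ht
  · rintro ν ⟨hν, hν0, hνt⟩
    have hprob : IsProbabilityMeasure (G.map h) :=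
      Measure.isProbabilityMeasure_map hmonoh.measurable.aemeasurable
    refine Measure.ext_of_Iic _ _ fun t => ?_
    rw [Measure.map_apply hmonoh.measurable measurableSet_Iic]
    rcases le_or_gt t 0 with ht | ht
    · have : h ⁻¹' Set.Iic t = ∅ := by
        ext x
        simpa using ht.trans_lt (hpos x)
      rw [this, measure_empty]
      exact measure_mono_null (Set.Iic_subset_Iic.2 ht) hν0
    · have h1 := hνt t ht
      rw [bsCdf, one_div_bsShape_mul_bsXi hm hs ht, cdf_eq_real] at h1
      have h2 : h ⁻¹' Set.Iic t = Set.Iic ((t * m - s) / t ^ (1 / α)) := by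
        ext x
        exact hle x t ht
      rw [h2]
      exact (measureReal_eq_measureReal_iff).1 h1

theorem cdf_gaussianReal_zero {v : ℝ≥0} (hv : v ≠ 0) (x : ℝ) :
    cdf (gaussianReal 0 v) x = cdf (gaussianReal 0 1) (x / √v) := by
  have hv' : 0 < √(v : ℝ) := Real.sqrt_pos.2 (by positivity)
  have hmap : (gaussianReal 0 1).map (√(v : ℝ) * ·) = gaussianReal 0 v := by
    rw [gaussianReal_map_const_mul, mul_zero, mul_one]
    congr 1
    ext
    exact Real.sq_sqrt v.2
  rw [cdf_eq_real, cdf_eq_real, ← hmap, map_measureReal_apply (by fun_prop) measurableSet_Iic]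
  congr 1
  ext y
  simp only [Set.mem_preimage, Set.mem_Iic]
  rw [le_div_iff₀ hv', mul_comm]

/-- For `α = 2` the distribution is the classical Birnbaum–Saunders law. -/
theorem bsCdf_gaussianReal {v : ℝ≥0} (hv : v ≠ 0) {m s : ℝ} (hm : 0 < m) (t : ℝ) :
    bsCdf (gaussianReal 0 v) 2 m s t = cdf (gaussianReal 0 1)
      (1 / (√v / √(m * s)) * (√(t / (s / m)) - 1 / √(t / (s / m)))) := by
  rw [bsCdf, cdf_gaussianReal_zero hv, bsShape, bsXi, bsScale,
    show (1 : ℝ) - 1 / 2 = 1 / 2 by norm_num, ← Real.sqrt_eq_rpow, ← Real.sqrt_eq_rpow,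
    ← Real.sqrt_eq_rpow, Real.sqrt_mul hm.le, one_div_one_div, one_div_div]
  congr 1
  ring

/-! ### Uniform approximation of the passage probabilities -/

section Approximation

variable {Ω : Type*} [MeasurableSpace Ω] {P : Measure Ω} [IsProbabilityMeasure P]
  {X : ℕ → Ω → ℝ} {G : Measure ℝ} [IsProbabilityMeasure G] [NullSingletonClass G] {α m : ℝ}

/-- Neither one more step nor a bounded change of the threshold affects the standardized level in
the limit. -/
theorem tendsto_shifted_standardization (hα : 0 < α) (c x : ℝ) :
    Tendsto (fun n : ℕ => (x * (n : ℝ) ^ (1 / α) + c) / ((n + 1 : ℕ) : ℝ) ^ (1 / α)) atTop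
      (𝓝 x) := by
  have h1 : Tendsto (fun n : ℕ => ((n : ℝ) / ((n : ℝ) + 1)) ^ (1 / α)) atTop (𝓝 1) := by
    have := (tendsto_natCast_div_add_atTop (1 : ℝ)).rpow_const (p := 1 / α)
      (Or.inr (by positivity))
    simpa using this
  have h2 : Tendsto (fun n : ℕ => c * ((n : ℝ) + 1) ^ (-(1 / α))) atTop (𝓝 (c * 0)) :=
    ((tendsto_rpow_neg_atTop (by positivity)).comp
      (tendsto_natCast_atTop_atTop.atTop_add tendsto_const_nhds)).const_mul _
  have h := (h1.const_mul x).add h2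
  simp only [mul_one, mul_zero, add_zero] at h
  refine h.congr fun n => ?_
  rw [Real.div_rpow (by positivity) (by positivity), Real.rpow_neg (by positivity)]
  push_cast
  ring

/-- Uniform approximation of the exceedance probability of the running maximum. -/
theorem eventually_abs_sub_cdf_le (hX : ∀ j, Measurable (X j)) (hindep : iIndepFun X P)
    (hident : ∀ j, IdentDistrib (X j) (X 0) P P) (hα : 1 < α) (hm : m = ∫ ω, X 0 ω ∂P)
    (hm0 : 0 < m)
    (hconv : ∀ x, Tendsto
      (fun n : ℕ => P.real {ω | n * m - x * (n : ℝ) ^ (1 / α) < partialSum X n ω}) atTop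
      (𝓝 (cdf G x))) {ε : ℝ} (hε : 0 < ε) :
    ∀ᶠ n : ℕ in atTop, ∀ s t p : ℝ, 0 < s → n ≤ t → t ≤ n + 1 →
      P.real {ω | ∃ k, 1 ≤ k ∧ k ≤ n ∧ s < partialSum X k ω} ≤ p →
      p ≤ P.real {ω | ∃ k, 1 ≤ k ∧ k ≤ n + 1 ∧ s < partialSum X k ω} →
      |p - cdf G ((t * m - s) / t ^ (1 / α))| ≤ ε := by
  have hα0 : 0 < α := by linarith
  obtain ⟨K, hK⟩ := ((tendsto_measureReal_exists_partialSum_le_neg hX hindep hident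
    (hm ▸ hm0)).eventually (eventually_le_nhds (show (0 : ℝ) < ε / 2 by positivity))).exists
  set H : ℕ → ℝ → ℝ := fun n x => P.real {ω | n * m - x * (n : ℝ) ^ (1 / α) < partialSum X n ω}
    with hH
  -- If `x` standardizes `s` at time `n`, then `y n x` standardizes `s - K` at time `n + 1`.
  set y : ℕ → ℝ → ℝ := fun n x =>
    (x * (n : ℝ) ^ (1 / α) + (m + K)) / ((n + 1 : ℕ) : ℝ) ^ (1 / α) with hy
  have hHmono : ∀ n, Monotone (H n) := fun n x x' hx => by
    refine measureReal_mono fun ω hω => ?_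
    simp only [Set.mem_ofPred_eq] at hω ⊢
    have : x * (n : ℝ) ^ (1 / α) ≤ x' * (n : ℝ) ^ (1 / α) := by gcongr
    linarith
  have hymono : ∀ n, Monotone (y n) := fun n x x' hx => by
    simp only [hy]
    gcongr
  have hpolya : ∀ F : ℕ → ℝ → ℝ, (∀ n, Monotone (F n)) → (∀ n x, 0 ≤ F n x) →
      (∀ n x, F n x ≤ 1) → (∀ x, Tendsto (F · x) atTop (𝓝 (cdf G x))) →
      TendstoUniformly F (cdf G) atTop := fun F h1 h2 h3 h4 =>
    tendstoUniformly_of_monotone h1 h2 h3 continuous_cdf (monotone_cdf G) (tendsto_cdf_atBot G)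
      (tendsto_cdf_atTop G) h4
  have hylim : ∀ x, Tendsto (fun n => y n x) atTop (𝓝 x) := fun x =>
    tendsto_shifted_standardization hα0 _ x
  have hLlim : ∀ x, Tendsto (fun n => cdf G (y n x)) atTop (𝓝 (cdf G x)) := fun x =>
    (continuous_cdf.tendsto x).comp (hylim x)
  have hHu := hpolya H hHmono (fun _ _ => measureReal_nonneg) (fun _ _ => measureReal_le_one) hconv
  have hLu := hpolya (fun n x => cdf G (y n x)) (fun n => (monotone_cdf G).comp (hymono n))
    (fun _ _ => cdf_nonneg _ _) (fun _ _ => cdf_le_one _ _) hLlim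
  -- Uniform convergence of `H` allows evaluation at the moving point `y n x`; Pólya's theorem then
  -- applies once more to the composition.
  have hJu := hpolya (fun n x => H (n + 1) (y n x)) (fun n => (hHmono _).comp (hymono n))
    (fun _ _ => measureReal_nonneg) (fun _ _ => measureReal_le_one) (fun x => by
      have h1 : Tendsto (fun n => H (n + 1) (y n x) - cdf G (y n x)) atTop (𝓝 0) := by
        rw [Metric.tendsto_nhds]
        intro δ hδ
        have := (tendsto_add_atTop_nat 1).eventually (Metric.tendstoUniformly_iff.1 hHu δ hδ)
        filter_upwards [this] with n hn
        have := hn (y n x)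
        rw [dist_comm, Real.dist_eq] at this
        rw [Real.dist_eq, sub_zero]
        exact this
      simpa using h1.add (hLlim x))
  have hδ : (0 : ℝ) < ε / 2 := by positivity
  filter_upwards [Metric.tendstoUniformly_iff.1 hHu _ hδ, Metric.tendstoUniformly_iff.1 hLu _ hδ,
    Metric.tendstoUniformly_iff.1 hJu _ hδ, eventually_gt_atTop 0] with n hHn hLn hJn hn
  -- The standardized level at `t` lies between `x` and `y n x`. Each side loses `ε / 2` twice:
  -- below, from `H n` and from the shift to `y n x`; above, from `H (n + 1)` at `y n x` and from
  -- the descent to `-K`.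
  intro s t p hs hnt htn hp1 hp2
  have hn' : (0 : ℝ) < n := by exact_mod_cast hn
  have hκ : (0 : ℝ) < (n : ℝ) ^ (1 / α) := by positivity
  have hκ' : (0 : ℝ) < ((n + 1 : ℕ) : ℝ) ^ (1 / α) := by positivity
  set x := (n * m - s) / (n : ℝ) ^ (1 / α) with hx
  have hxκ : x * (n : ℝ) ^ (1 / α) = n * m - s := by rw [hx]; field_simp
  have hyκ : y n x * ((n + 1 : ℕ) : ℝ) ^ (1 / α) = n * m - s + (m + K) := by
    simp only [hy]; rw [hxκ]; field_simp
  have hHx : H n x = P.real {ω | s < partialSum X n ω} := by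
    simp only [hH]; rw [hxκ]; simp
  have hJx : H (n + 1) (y n x) = P.real {ω | s - K < partialSum X (n + 1) ω} := by
    simp only [hH]; rw [hyκ]
    push_cast
    congr 2
    ext ω
    constructor <;> intro h <;> linarith
  have hmono := (strictMonoOn_standardized hα hm0 hs).monotoneOn
  have ht : 0 < t := hn'.trans_le hnt
  have hxt : x ≤ (t * m - s) / t ^ (1 / α) := hmono hn' ht hnt
  have hty : (t * m - s) / t ^ (1 / α) ≤ y n x := by
    refine (hmono ht (show (0 : ℝ) < ((n + 1 : ℕ) : ℝ) by positivity)
      (by push_cast; exact htn)).trans ?_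
    simp only
    rw [div_le_iff₀ hκ', hyκ]
    have : (0 : ℝ) ≤ K := by positivity
    push_cast
    linarith
  have hΦ1 := monotone_cdf G hxt
  have hΦ2 := monotone_cdf G hty
  have hlow : P.real {ω | s < partialSum X n ω} ≤ p :=
    le_trans (measureReal_mono (Set.ofPred_subset_ofPred.2 fun ω hω => ⟨n, hn, le_rfl, hω⟩)) hp1
  have hup := hp2.trans (measureReal_exists_lt_partialSum_le hX hindep hident (n + 1) s K)
  have e1 := hHn x
  have e2 := hLn x
  have e3 := hJn x
  rw [Real.dist_eq, abs_lt] at e1 e2 e3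
  rw [hHx] at e1
  rw [hJx] at e3
  rw [abs_le]
  constructor <;> linarith

/-- The laws of the discrete and of the continuous passage times are approximated by the
generalized Birnbaum–Saunders law, uniformly as the larger of `s` and `t` grows. -/
theorem exists_forall_abs_sub_bsCdf_le (hX : ∀ j, Measurable (X j)) (hindep : iIndepFun X P)
    (hident : ∀ j, IdentDistrib (X j) (X 0) P P) (hα : 1 < α) (hm : m = ∫ ω, X 0 ω ∂P)
    (hm0 : 0 < m)
    (hconv : ∀ x, Tendsto
      (fun n : ℕ => P.real {ω | n * m - x * (n : ℝ) ^ (1 / α) < partialSum X n ω}) atTop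
      (𝓝 (cdf G x))) {ε : ℝ} (hε : 0 < ε) :
    ∃ M : ℝ, ∀ s t : ℝ, 0 < s → 0 < t → M ≤ max s t →
      |P.real {ω | (cyclesToFailure X s ω : ℝ≥0∞) ≤ ENNReal.ofReal t} - bsCdf G α m s t| ≤ ε ∧
      |P.real {ω | fatigueLife X s ω ≤ ENNReal.ofReal t} - bsCdf G α m s t| ≤ ε := by
  have hα0 : 0 < α := by linarith
  have hsand : ∀ s t : ℝ, 0 < s → 0 < t → ∀ p : ℝ,
      (p = P.real {ω | (cyclesToFailure X s ω : ℝ≥0∞) ≤ ENNReal.ofReal t} ∨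
        p = P.real {ω | fatigueLife X s ω ≤ ENNReal.ofReal t}) →
      P.real {ω | ∃ k, 1 ≤ k ∧ k ≤ ⌊t⌋₊ ∧ s < partialSum X k ω} ≤ p ∧
      p ≤ P.real {ω | ∃ k, 1 ≤ k ∧ k ≤ ⌊t⌋₊ + 1 ∧ s < partialSum X k ω} := by
    rintro s t hs ht p (rfl | rfl)
    · constructor
      · exact measureReal_mono fun ω hω => (cyclesToFailure_le_ofReal_iff ht.le).2 hω
      · refine measureReal_mono fun ω hω => ?_
        obtain ⟨k, h1, h2, h3⟩ := (cyclesToFailure_le_ofReal_iff ht.le).1 hω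
        exact ⟨k, h1, by omega, h3⟩
    · constructor
      · refine measureReal_mono fun ω hω => ?_
        obtain ⟨k, -, h2, h3⟩ := hω
        exact fatigueLife_le_of_lt_partialSum ht.le h2 h3
      · exact measureReal_mono fun ω hω => exists_lt_partialSum_of_fatigueLife_le hs hω
  suffices hmain : ∃ M : ℝ, ∀ s t : ℝ, 0 < s → 0 < t → M ≤ max s t → ∀ p : ℝ,
      P.real {ω | ∃ k, 1 ≤ k ∧ k ≤ ⌊t⌋₊ ∧ s < partialSum X k ω} ≤ p →
      p ≤ P.real {ω | ∃ k, 1 ≤ k ∧ k ≤ ⌊t⌋₊ + 1 ∧ s < partialSum X k ω} →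
      |p - bsCdf G α m s t| ≤ ε by
    obtain ⟨M, hM⟩ := hmain
    refine ⟨M, fun s t hs ht hst => ⟨?_, ?_⟩⟩
    · have h := hsand s t hs ht _ (Or.inl rfl)
      exact hM s t hs ht hst _ h.1 h.2
    · have h := hsand s t hs ht _ (Or.inr rfl)
      exact hM s t hs ht hst _ h.1 h.2
  obtain ⟨N, hN⟩ := eventually_atTop.1
    (eventually_abs_sub_cdf_le hX hindep hident hα hm hm0 hconv hε)
  have hN1 : (0 : ℝ) < N + 1 := by positivity
  obtain ⟨S, hS⟩ := ((tendsto_measureReal_exists_lt_partialSum (P := P) hX (N + 1)).eventually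
    (eventually_le_nhds hε)).exists
  have hΦ : Tendsto (fun s : ℝ => cdf G (((N + 1) * m - s) / (N + 1 : ℝ) ^ (1 / α))) atTop
      (𝓝 0) := by
    refine (tendsto_cdf_atBot G).comp ?_
    refine Tendsto.atBot_div_const (by positivity) ?_
    exact tendsto_const_nhds.add_atBot tendsto_neg_atTop_atBot
  obtain ⟨S', hS'⟩ := eventually_atTop.1 (hΦ.eventually (eventually_le_nhds hε))
  -- If `t < N + 1`, the bound on `max s t` must come from `s`; then `S` makes the passage
  -- probability at most `ε` and `S'` does the same for the limit law.
  refine ⟨max (N + 1) (max S S'), fun s t hs ht hst p hp1 hp2 => ?_⟩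
  rw [bsCdf, one_div_bsShape_mul_bsXi hm0 hs ht]
  rcases le_or_gt (N + 1 : ℝ) t with hNt | hNt
  · refine hN ⌊t⌋₊ ?_ s t p hs (Nat.floor_le ht.le) (Nat.lt_floor_add_one t).le hp1 hp2
    exact Nat.le_floor (by linarith)
  · have hs' : max (S : ℝ) S' ≤ s := by
      rcases le_max_iff.1 hst with h | h
      · exact (le_max_right _ _).trans h
      · exact absurd ((le_max_left _ _).trans h) (not_le.2 hNt)
    have hfl : ⌊t⌋₊ + 1 ≤ N + 1 := by
      have : ⌊t⌋₊ < N + 1 := (Nat.floor_lt ht.le).2 (by exact_mod_cast hNt)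
      omega
    have hpε : p ≤ ε := by
      refine hp2.trans (le_trans (measureReal_mono ?_) hS)
      rintro ω ⟨k, h1, h2, h3⟩
      exact ⟨k, h1, h2.trans hfl, ((le_max_left _ _).trans hs').trans_lt h3⟩
    have hp0 : 0 ≤ p := measureReal_nonneg.trans hp1
    have hΦ1 := hS' s ((le_max_right _ _).trans hs')
    have hΦ2 := monotone_cdf G ((strictMonoOn_standardized hα hm0 hs).monotoneOn ht hN1 hNt.le)
    have hΦ0 := cdf_nonneg G ((t * m - s) / t ^ (1 / α))
    rw [abs_le]
    constructor <;> linarith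

end Approximation

/-! ### Assembly of the cases `α = 2` and `α < 2` -/

theorem tendsto_measureReal_partialSum_of_charFun {Ω : Type*} [MeasurableSpace Ω] {P : Measure Ω}
    [IsProbabilityMeasure P] {X : ℕ → Ω → ℝ} (hX : ∀ j, Measurable (X j)) {α σ m : ℝ} (hα : 0 < α)
    (hσ : 0 < σ) {G : Measure ℝ} (hG : IsSymmStable α σ 0 G)
    (h : ∀ u, Tendsto (fun n : ℕ => charFun
      (P.map (fun ω => (n : ℝ) ^ (-(1 / α)) * (partialSum X n ω - n * m))) u) atTop
      (𝓝 (charFun G u))) (x : ℝ) :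
    Tendsto (fun n : ℕ => P.real {ω | n * m - x * (n : ℝ) ^ (1 / α) < partialSum X n ω}) atTop
      (𝓝 (cdf G x)) := by
  refine (hG.tendsto_measureReal_gt (fun n => ?_) hα hσ h x).congr' ?_
  · exact ((measurable_partialSum hX n).sub_const _).const_mul _
  filter_upwards [eventually_gt_atTop 0] with n hn
  have hκ : (0 : ℝ) < (n : ℝ) ^ (1 / α) := by positivity
  congr 1
  ext ω
  simp only [Set.mem_ofPred_eq]
  rw [Real.rpow_neg (by positivity), inv_mul_eq_div, lt_div_iff₀ hκ]
  constructor <;> intro h <;> linarith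

theorem proposition2p4 {Ω : Type*} [MeasurableSpace Ω] (P : Measure Ω) [IsProbabilityMeasure P]
    (X : ℕ → Ω → ℝ) (hX : ∀ j, Measurable (X j)) (hindep : iIndepFun X P)
    (hident : ∀ j, IdentDistrib (X j) (X 0) P P)
    (α σ μ : ℝ) (hα : 1 < α) (hα2 : α ≤ 2) (hσ : 0 < σ)
    (G : Measure ℝ) (hG : IsSymmStable α σ μ G)
    (hd : mallowsDist α (P.map (X 0)) G < ∞)
    (hmean : 0 < ∫ ω, X 0 ω ∂P)
    (hvar : α = 2 → 0 < evariance (X 0) P) :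
    (α = 2 → MemLp (X 0) 2 P) ∧
    ∃ G₀ : Measure ℝ,
      -- `G₀` is `S_α(σ, 0, 0)`, where for `α = 2` the scale is `σ_X / √2`
      IsSymmStable α (if α = 2 then √(variance (X 0) P) / √2 else σ) 0 G₀ ∧
      -- the relation defines a probability distribution on `(0, ∞)`
      (∀ s : ℝ, 0 < s → ∃! ν : Measure ℝ, IsProbabilityMeasure ν ∧ ν (Set.Iic 0) = 0 ∧
        ∀ t : ℝ, 0 < t → ν.real (Set.Iic t) = bsCdf G₀ α (∫ ω, X 0 ω ∂P) s t) ∧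
      -- it approximates the laws of `N_*` and of `T_*`, uniformly as `max s t → ∞`
      (∀ ε : ℝ, 0 < ε → ∃ M : ℝ, ∀ s t : ℝ, 0 < s → 0 < t → M ≤ max s t →
        |P.real {ω | (cyclesToFailure X s ω : ℝ≥0∞) ≤ ENNReal.ofReal t}
            - bsCdf G₀ α (∫ ω, X 0 ω ∂P) s t| ≤ ε ∧
        |P.real {ω | fatigueLife X s ω ≤ ENNReal.ofReal t}
            - bsCdf G₀ α (∫ ω, X 0 ω ∂P) s t| ≤ ε) ∧
      -- for `α = 2` it is the classical Birnbaum–Saunders distribution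
      (α = 2 → ∀ s t : ℝ, 0 < s → 0 < t →
        bsCdf G₀ α (∫ ω, X 0 ω ∂P) s t =
          cdf (gaussianReal 0 1)
            (1 / (√(variance (X 0) P) / √((∫ ω, X 0 ω ∂P) * s)) *
              (√(t / (s / ∫ ω, X 0 ω ∂P)) - 1 / √(t / (s / ∫ ω, X 0 ω ∂P))))) := by
  -- The Bochner integral of a non-integrable function is `0`, so a positive mean implies
  -- integrability.
  have hint : Integrable (X 0) P := .of_integral_ne_zero hmean.ne'
  have hL : α = 2 → MemLp (X 0) 2 P := by
    rintro rfl
    exact memLp_two_of_mallowsDist (hX 0) hG hd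
  refine ⟨hL, ?_⟩
  by_cases hcase : α = 2
  · subst hcase
    have hv : 0 < variance (X 0) P :=
      ENNReal.toReal_pos (hvar rfl).ne' (hL rfl).evariance_lt_top.ne
    have hv' : ((variance (X 0) P).toNNReal : ℝ) = variance (X 0) P :=
      Real.coe_toNNReal _ hv.le
    have hG₀ := isSymmStable_gaussianReal (variance (X 0) P).toNNReal
    rw [hv'] at hG₀
    have hscale : 0 < √(variance (X 0) P) / √2 := by positivity
    have := hG₀.nullSingletonClass two_pos hscale
    refine ⟨_, by simpa using hG₀, fun s hs => existsUnique_bsCdf hα hmean hs, fun ε hε => ?_,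
      fun _ s t _ _ => ?_⟩
    · exact exists_forall_abs_sub_bsCdf_le hX hindep hident hα rfl hmean
        (tendsto_measureReal_partialSum_of_charFun hX two_pos hscale hG₀
          (tendsto_charFun_partialSum_of_memLp_two hindep hident (hL rfl))) hε
    · have h := bsCdf_gaussianReal (v := (variance (X 0) P).toNNReal) (by simpa using hv) hmean
        (s := s) t
      rwa [hv'] at h
  · have hα0 : 0 < α := by linarith
    have hG₀ := hG.map_sub_const
    have := hG₀.isProbabilityMeasure
    have := hG₀.nullSingletonClass hα0 hσ
    refine ⟨_, by simpa [hcase] using hG₀, fun s hs => existsUnique_bsCdf hα hmean hs,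
      fun ε hε => ?_, fun h => absurd h hcase⟩
    exact exists_forall_abs_sub_bsCdf_le hX hindep hident hα rfl hmean
      (tendsto_measureReal_partialSum_of_charFun hX hα0 hσ hG₀
        (tendsto_charFun_partialSum_of_mallowsDist hX hindep hident hα
          (lt_of_le_of_ne hα2 hcase) hG hd hint)) hε
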